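/- **Setting.** Let $H$ be a positive semidefinite Hamiltonian on $n$ qubits with eigenpairs $(\lambda_k,|\psi_k\rangle)$, $\lambda_0\le\lambda_1\le\cdots$, and suppose that $\lambda_0\le\mu-\Delta/2<\mu+\Delta/2\le\lambda_1$ for known $\mu$ and $\Delta>0$. Let $O_I$ be a unitary with $O_I|0^n\rangle=|\phi\rangle$, $|\langle\phi|\psi_0\rangle|=\gamma>0$. For a cutoff time $\tau>0$ and a precision $\delta>0$ let $O_H(t)$, $|t|\le\tau$, be unitaries with $\sup_{|t|\le\tau}\|O_H(t)-e^{-\mathrm iHt}\|\le\delta$; a (controlled) query to $O_H(t)$ costs at most $\kappa$ gates, independently of $t$ and $\|H\|$ ($\tau$-cutoff fast-forwarding, $\alpha=0$). Let $\sigma\ge0$ be a known shift of the spectrum with $\sigma\le\lambda_0\le\sigma+\pi/4$. **Circuits.** All circuits act on the $n$ system qubits and one ancilla qubit, and consist of queries to $O_I$, rotations $e^{\mathrm i\theta X}$ and $Z$-rotations of the ancilla, ancilla-controlled queries to $O_H$, and measurements of the ancilla. The controlled evolution $e^{-\mathrm it(H-\sigma)}$ is synthesized from $r=\lceil|t|/\tau\rceil$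 controlled queries to $O_H(t/r)$ and one $Z$-rotation. A QETU circuit of even degree $d$ and time $t$, with symmetric phase factors $\varphi_j=\varphi_{d-j}$, is the sequence of rotations $e^{\mathrm i\varphi_0X},\dots,e^{\mathrm i\varphi_dX}$ of the ancilla interleaved with the controlled evolutions for times $t,-t,t,-t,\dots$. One attempt of the multi-level method prepares $|0\rangle\otimes O_I|0^n\rangle$, applies for $\ell=1,\dots,L$ QETU circuits with the same phase factors and times $t_\ell=2^\ell/\|H\|$, and then a clean-up QETU circuit with its own phase factors and time; after each QETU circuit the ancilla is measured, and the attempt is aborted unless the outcome is $0$. The algorithm makes at most $R$ independent attempts, stops at the first in which all outcomes are $0$, and outputs the system state $|\psi\rangle$ of that attempt. If $\Delta\le1$, then $L=\lceil\log_2(\|H\|/2)\rceil$ and the clean-up time is $1$. **Theorem.** Suppose that $0<\epsilon<1$, $\|H\|\ge\pi$ and $\epsilon\le\gamma^{-1}\,\log_2(\|H\|/2)^{-1}\,\ln(3/2)$. There are a multi-level circuit, a number $R$ of attempts and a precision $\delta>0$, which depend only on $\gamma,\|H\|,\Delta,\mu,\tau,\epsilon,\sigma$ (not on $n$ and not otherwise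 on $H$, $O_I$, $O_H$), such that with probability at least $2/3$ some attempt succeeds, the output then has fidelity $|\langle\psi_0|\psi\rangle|^2\ge1-\epsilon$, and the total cost is 1. $\mathcal O(\gamma^{-2})$ queries to $O_I$, 2. $(\kappa+1)\cdot\widetilde{\mathcal O}(X)$ gates, where $X=\gamma^{-2}\bigl(\log\|H\|+(1+\tau^{-1})\Delta^{-1}\bigr)\log(2/\epsilon)$, 3. one ancilla qubit. Here $\mathcal O$ hides a universal constant, and $\widetilde{\mathcal O}(X)$ means at most $C\,X\,\log(2+X)^k$ with universal constants $C,k$. -/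

import Mathlib

noncomputable section

namespace MultiLevelQETU

/-- The state space of an `n`-qubit system register. -/
abbrev Sys (n : ℕ) : Type := EuclideanSpace ℂ (Fin (2 ^ n))

/-- The state space of one ancilla qubit together with the system register: the (possibly
unnormalized) vector `|0⟩ ⊗ v 0 + |1⟩ ⊗ v 1` is represented by its two components. -/
abbrev Joint (n : ℕ) : Type := Fin 2 → Sys n

/-- The all-zero computational basis state of the system register. -/
def zeroSys (n : ℕ) : Sys n := EuclideanSpace.single 0 1

/-- The state in which the ancilla and all system qubits are zero. -/
def zeroJoint (n : ℕ) : Joint n := ![zeroSys n, 0]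

/-- The exact Hamiltonian evolution `exp(-i t H)`. -/
def evolution {n : ℕ} (H : Sys n →L[ℂ] Sys n) (t : ℝ) : Sys n →L[ℂ] Sys n :=
  NormedSpace.exp ((-(Complex.I * (t : ℂ))) • H)

/-- `OH` implements the evolution of `H` with precision `δ` for all times up to the cutoff `τ`.
Nothing is said about `OH t` for `|t| > τ`. -/
def IsCutoffEvolution {n : ℕ} (τ δ : ℝ) (H : Sys n →L[ℂ] Sys n)
    (OH : ℝ → Sys n →L[ℂ] Sys n) : Prop :=
  ∀ t : ℝ, |t| ≤ τ → OH t ∈ unitary (Sys n →L[ℂ] Sys n) ∧ ‖OH t - evolution H t‖ ≤ δ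

/-- `lam` and `psi` are the eigenpairs of `H`, in increasing order of the eigenvalues. -/
def IsEigensystem {n : ℕ} (H : Sys n →L[ℂ] Sys n) (lam : Fin (2 ^ n) → ℝ)
    (psi : OrthonormalBasis (Fin (2 ^ n)) ℂ (Sys n)) : Prop :=
  Monotone lam ∧ ∀ k, H (psi k) = (lam k : ℂ) • psi k

/-- The elementary operations. There is a single ancilla qubit. -/
inductive Instr : Type
  /-- one query to the initial-state oracle, on the system register -/
  | initQuery : Instr
  /-- the rotation `exp(i θ X)` of the ancilla -/
  | rotX (θ : ℝ) : Instr
  /-- the `Z`-rotation of the ancilla, up to a global phase: `diag(1, exp(i θ))` -/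
  | phaseZ (θ : ℝ) : Instr
  /-- one query to the evolution oracle at time `t`, controlled by the ancilla -/
  | evolve (t : ℝ) : Instr
  /-- measure the ancilla; proceed on outcome 0, abort the attempt on outcome 1 -/
  | measure : Instr

/-- The matrix of `exp(i θ X)`. -/
def rotXMatrix (θ : ℝ) : Matrix (Fin 2) (Fin 2) ℂ :=
  !![(Real.cos θ : ℂ), Complex.I * (Real.sin θ : ℂ);
     Complex.I * (Real.sin θ : ℂ), (Real.cos θ : ℂ)]

/-- The effect of an operation on the state, for given oracles. A measurement projects on outcome
0 without renormalizing, so that the squared norm of the state is the probability that the attempt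
has not been aborted so far. -/
def Instr.apply {n : ℕ} (OI : Sys n →L[ℂ] Sys n) (OH : ℝ → Sys n →L[ℂ] Sys n) :
    Instr → Joint n → Joint n
  | .initQuery, v => fun i => OI (v i)
  | .rotX θ, v => fun i => ∑ j, rotXMatrix θ i j • v j
  | .phaseZ θ, v => ![v 0, Complex.exp (Complex.I * (θ : ℂ)) • v 1]
  | .evolve t, v => ![v 0, OH t (v 1)]
  | .measure, v => ![v 0, 0]

/-- The state after a list of operations, performed from left to right on the all-zero state. -/
def run {n : ℕ} (OI : Sys n →L[ℂ] Sys n) (OH : ℝ → Sys n →L[ℂ] Sys n) (c : List Instr) :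
    Joint n :=
  c.foldl (fun v g => g.apply OI OH v) (zeroJoint n)

/-- The number of queries to the initial-state oracle made by one operation. -/
def Instr.initQueries : Instr → ℕ
  | .initQuery => 1
  | _ => 0

/-- The number of gates of one operation, if one controlled query to the evolution oracle costs `κ`
gates, whatever the evolution time. Queries to the initial-state oracle are counted separately. -/
def Instr.gates (κ : ℕ) : Instr → ℕ
  | .initQuery => 0
  | .evolve _ => κ
  | _ => 1

/-- The ancilla-controlled evolution `exp(-i t (H - σ))`, synthesized from `⌈|t| / τ⌉` queries to the
evolution oracle and a rotation that accounts for the shift `σ` of the spectrum. -/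
def controlledEvolution (τ σ t : ℝ) : List Instr :=
  List.replicate ⌈|t| / τ⌉₊ (.evolve (t / ⌈|t| / τ⌉₊)) ++ [.phaseZ (σ * t)]

/-- A symmetric sequence `φ 0, …, φ (2 m)` of phase factors. -/
structure Phases : Type where
  m : ℕ
  φ : ℕ → ℝ
  symm : ∀ j ≤ 2 * m, φ j = φ (2 * m - j)

/-- The QETU circuit of degree `d = 2 m` for the shifted Hamiltonian `H - σ` and time `t`: the
`2 m + 1` rotations `exp(i φ_j X)` of the ancilla, interleaved with the controlled evolutions for
the times `t, -t, t, -t, …`. -/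
def qetu (τ σ t : ℝ) (P : Phases) : List Instr :=
  .rotX (P.φ 0) :: (List.range P.m).flatMap fun j =>
    controlledEvolution τ σ t ++ .rotX (P.φ (2 * j + 1)) ::
      (controlledEvolution τ σ (-t) ++ [.rotX (P.φ (2 * j + 2))])

/-- The data of a multi-level circuit: the number of levels, the phase factors common to all the
levels, and the phase factors and the evolution time of the clean-up filter. -/
structure MultiLevel : Type where
  levels : ℕ
  levelPhases : Phases
  cleanPhases : Phases
  cleanTime : ℝ

/-- One attempt: prepare the initial guess; apply the QETU circuits with the dyadic evolution times
`2 ^ ℓ / Λ` for `ℓ = 1, …, L`; apply the clean-up QETU circuit. Each of these circuits is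
followed by a measurement of the ancilla. -/
def MultiLevel.attempt (A : MultiLevel) (Λ τ σ : ℝ) : List Instr :=
  .initQuery ::
    (((List.range A.levels).flatMap fun l =>
        qetu τ σ (2 ^ (l + 1) / Λ) A.levelPhases ++ [.measure]) ++
      (qetu τ σ A.cleanTime A.cleanPhases ++ [.measure]))

/-- The unnormalized system state at the end of an attempt in which all outcomes are 0. -/
def MultiLevel.output {n : ℕ} (A : MultiLevel) (Λ τ σ : ℝ) (OI : Sys n →L[ℂ] Sys n)
    (OH : ℝ → Sys n →L[ℂ] Sys n) : Sys n :=
  run OI OH (A.attempt Λ τ σ) 0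

/-- The probability that one of at most `R` independent attempts succeeds, if each of them
succeeds with probability `p` and a new one is started only after a failure. -/
def retryProb (p : ℝ) : ℕ → ℝ
  | 0 => 0
  | R + 1 => p + (1 - p) * retryProb p R

/-- The probability that post-selection succeeds in one of at most `R` attempts. -/
def MultiLevel.successProb {n : ℕ} (A : MultiLevel) (R : ℕ) (Λ τ σ : ℝ)
    (OI : Sys n →L[ℂ] Sys n) (OH : ℝ → Sys n →L[ℂ] Sys n) : ℝ :=
  retryProb (‖A.output Λ τ σ OI OH‖ ^ 2) R

/-- The number of queries to the initial-state oracle in `R` attempts. -/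
def MultiLevel.totalInitQueries (A : MultiLevel) (R : ℕ) (Λ τ σ : ℝ) : ℕ :=
  R * ((A.attempt Λ τ σ).map Instr.initQueries).sum

/-- The number of gates in `R` attempts, if one query to the evolution oracle costs `κ` gates. -/
def MultiLevel.totalGates (A : MultiLevel) (R κ : ℕ) (Λ τ σ : ℝ) : ℕ :=
  R * ((A.attempt Λ τ σ).map (Instr.gates κ)).sum

/-- The fidelity `|⟨ψ|v⟩|²` of the normalization of `v` with the unit vector `ψ`. -/
def fidelity {n : ℕ} (ψ v : Sys n) : ℝ :=
  ‖inner ℂ ψ (((‖v‖ : ℂ)⁻¹) • v)‖ ^ 2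

/-- The quantity `γ⁻² (log Λ + (1 + τ⁻¹) Δ⁻¹) log(2/ε)`. -/
def costScale (γ Λ Δ τ ε : ℝ) : ℝ :=
  γ⁻¹ ^ 2 * (Real.log Λ + (1 + τ⁻¹) * Δ⁻¹) * Real.log (2 / ε)

end MultiLevelQETU

end

/-!
An attempt acts on every eigenstate separately: on the component of energy `λ`, a QETU circuit of
time `t` that is followed by outcome `0` multiplies the amplitude by the upper left entry of a product of
`2 × 2` matrices that depends only on the angle `θ = t (λ - σ)`. The proof chooses these entries.

*Phase factors* (`exists_phases`). Every real polynomial `f (cos θ)` of degree at most `m` with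
`|f| < 1` on `[-1, 1]` is such an entry, for at most `2 m + 1` symmetric phase factors. First
`1 - f² = b² + (1 - x²) g²` by the theorems of Fejér–Riesz and Markov–Lukács
(`exists_sq_add_sq_eq`), which completes `f` to the unitary matrix `f + i (b X + sin θ g Y)`;
then layers are stripped off this matrix until it is constant
(`exists_phases_of_sq_add_sq_eq_one`).

*Filters* (`exists_phases_filter`). Convolving the indicator function of an interval with a
normalized power of the Fejér kernel gives a polynomial in `cos θ` with values in `[0, 1]`, `η`-close to
`1` on `[0, θa]` and to `0` on `[θb, π]`, of degree `O (w⁻¹ log (1 / (w η)))` for `w = θb - θa`.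

*Levels* (`MultiLevel.le_norm_amplitude`, `MultiLevel.norm_amplitude_le`). The common filter of the levels
has the transition region `[π / 4, π / 2]`. The angle of the ground state never exceeds `π / 4`, so
that the ground state keeps most of its amplitude. The angle of an excited state doubles from one level
to the next, so that it cannot jump over the stop band `[π / 2, 3 π / 2]`: either some level stops the
state, or its angle in the clean-up filter is below `π`, and the clean-up filter,
whose transition region has the width of the spectral gap, stops it.

*Errors and cost*. Errors of the evolution oracle add up over the circuit
(`jointNorm_runFrom_sub_runFrom_le`), so that `δ` can be chosen small enough not to matter.
With `η` of order `ε γ / (L + 1)`, the output of an attempt has norm at least `γ / 2` and the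
required fidelity (`output_bounds`), and `O (γ⁻²)` attempts suffice. The evolution times of
the levels form a geometric series with sum `O (1 / max (1, Δ))`, which gives the gate
count (`gates_filters_le`, `attempt_cost_le`); the logarithms of `1 / η` and of the inverse width of the
transition region are absorbed by `log (2 / ε)` and by the logarithm of the cost scale
(`log_overhead_le`).
-/

namespace MultiLevelQETU

section Polynomials

open Polynomial MeasureTheory

/-! ### Fejér–Riesz and Markov–Lukács representations -/

/-- The real linear factor of the Fejér–Riesz theorem. -/
theorem exists_norm_sq_eq_abs_sub {r : ℝ} (hr : 1 < |r|) :
    ∃ Q : ℝ[X], Q.natDegree ≤ 1 ∧ ∀ w : ℂ, ‖w‖ = 1 → ‖aeval w Q‖ ^ 2 = |w.re - r| := by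
  set a := √(|r| + 1) with ha
  set b := √(|r| - 1) with hb
  have ha2 : a ^ 2 = |r| + 1 := Real.sq_sqrt (by positivity)
  have hb2 : b ^ 2 = |r| - 1 := Real.sq_sqrt (by linarith)
  obtain ⟨s, hs, hsr⟩ : ∃ s : ℝ, s ^ 2 = 1 ∧ s * r = |r| := by
    rcases le_total 0 r with h | h
    · exact ⟨1, by norm_num, by rw [abs_of_nonneg h]; ring⟩
    · exact ⟨-1, by norm_num, by rw [abs_of_nonpos h]; ring⟩
  refine ⟨C (-(s * ((a - b) / 2))) * X + C ((a + b) / 2), natDegree_linear_le, fun w hw => ?_⟩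
  have hw2 : w.re ^ 2 + w.im ^ 2 = 1 := by
    have := Complex.sq_norm w
    rw [hw, Complex.normSq_apply] at this
    linarith
  have hre : |w.re| ≤ 1 := hw ▸ Complex.abs_re_le_norm w
  have h1 : |w.re - r| = |r| - s * w.re := by
    have : s * (r - w.re) = |r| - s * w.re := by linear_combination hsr
    rw [← this, abs_sub_comm]
    have hs1 : |s| = 1 := by
      rw [← sq_eq_sq₀ (abs_nonneg s) zero_le_one, sq_abs, hs, one_pow]
    rw [← one_mul |r - w.re|, ← hs1, ← abs_mul, abs_of_nonneg]
    rw [this]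
    have : s * w.re ≤ 1 := (le_abs_self _).trans (by rw [abs_mul, hs1, one_mul]; exact hre)
    linarith
  rw [h1, Complex.sq_norm, Complex.normSq_apply]
  simp only [map_add, map_mul, aeval_C, aeval_X, Complex.coe_algebraMap, Complex.add_re,
    Complex.mul_re, Complex.ofReal_re, Complex.ofReal_im, Complex.add_im, Complex.mul_im]
  linear_combination ((a - b) / 2) ^ 2 * s ^ 2 * hw2 + ((a - b) / 2) ^ 2 * hs
    + (1 / 2 - s * w.re / 2) * ha2 + (1 / 2 + s * w.re / 2) * hb2

/-- The quadratic factor of the Fejér–Riesz theorem. With `z = (s + s⁻¹) / 2` one has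
`z - Re w = (1 - s w) (1 - s w⁻¹) / (2 s)` on the unit circle. -/
theorem exists_norm_sq_eq_quadratic (z : ℂ) :
    ∃ Q : ℝ[X], Q.natDegree ≤ 2 ∧ ∀ w : ℂ, ‖w‖ = 1 →
      ‖aeval w Q‖ ^ 2 = |(X ^ 2 - C (2 * z.re) * X + C (‖z‖ ^ 2) : ℝ[X]).eval w.re| := by
  obtain ⟨c, hc⟩ := IsAlgClosed.exists_pow_nat_eq (z ^ 2 - 1) two_pos
  set s := z + c with hs
  have hs2 : s ^ 2 + 1 = 2 * z * s := by rw [hs]; linear_combination hc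
  have hs0 : s ≠ 0 := by
    intro h
    rw [h] at hs2
    norm_num at hs2
  have hsn : ‖s‖ ≠ 0 := norm_ne_zero_iff.2 hs0
  refine ⟨C ((2 * ‖s‖)⁻¹) * (C (‖s‖ ^ 2) * X ^ 2 + C (-(2 * s.re)) * X + C 1), ?_, fun w hw => ?_⟩
  · exact (natDegree_C_mul_le _ _).trans natDegree_quadratic_le
  have hconj : starRingEnd ℂ w * w = 1 := by
    rw [Complex.conj_mul', hw]; norm_num
  have hre : w + starRingEnd ℂ w = 2 * (w.re : ℂ) := by rw [Complex.add_conj]; push_cast; ring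
  have hsre : s + starRingEnd ℂ s = 2 * (s.re : ℂ) := by rw [Complex.add_conj]; push_cast; ring
  have hss : s * starRingEnd ℂ s = (‖s‖ : ℂ) ^ 2 := Complex.mul_conj' s
  have e1 : aeval w (C ((2 * ‖s‖)⁻¹) * (C (‖s‖ ^ 2) * X ^ 2 + C (-(2 * s.re)) * X + C 1) : ℝ[X])
      = (((2 * ‖s‖)⁻¹ : ℝ) : ℂ) * ((1 - s * w) * (1 - starRingEnd ℂ s * w)) := by
    simp only [map_add, map_mul, aeval_C, aeval_X, Complex.coe_algebraMap, map_pow]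
    push_cast
    linear_combination (2 * (‖s‖ : ℂ))⁻¹ * (w * hsre - w ^ 2 * hss)
  have e2 : ‖1 - starRingEnd ℂ s * w‖ = ‖1 - s * starRingEnd ℂ w‖ := by
    rw [← Complex.norm_conj]; simp
  have e3 : (1 - s * w) * (1 - s * starRingEnd ℂ w) = 2 * s * (z - w.re) := by
    linear_combination s ^ 2 * hconj - s * hre + hs2
  have e4 : ‖aeval w (C ((2 * ‖s‖)⁻¹) * (C (‖s‖ ^ 2) * X ^ 2 + C (-(2 * s.re)) * X + C 1) : ℝ[X])‖
      = ‖z - w.re‖ := by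
    rw [e1, norm_mul, norm_mul, e2, ← norm_mul, e3, norm_mul, norm_mul, Complex.norm_real,
      Real.norm_of_nonneg (by positivity), Complex.norm_ofNat]
    field_simp
  have e5 : (X ^ 2 - C (2 * z.re) * X + C (‖z‖ ^ 2) : ℝ[X]).eval w.re = ‖z - w.re‖ ^ 2 := by
    rw [Complex.sq_norm, Complex.sq_norm, Complex.normSq_apply, Complex.normSq_apply]
    simp
    ring
  rw [e4, e5, abs_of_nonneg (by positivity)]

/-- **Fejér–Riesz**, for a real polynomial in `Re w` without zeros in `[-1, 1]`. -/
theorem exists_norm_sq_eq_abs_eval (G : ℝ[X])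
    (hG : ∀ x ∈ Set.Icc (-1 : ℝ) 1, G.eval x ≠ 0) :
    ∃ Q : ℝ[X], Q.natDegree ≤ G.natDegree ∧
      ∀ w : ℂ, ‖w‖ = 1 → ‖aeval w Q‖ ^ 2 = |G.eval w.re| := by
  induction hn : G.natDegree using Nat.strong_induction_on generalizing G with
  | _ n ih =>
  have hG0 : G ≠ 0 := fun h => hG 0 (by norm_num) (by simp [h])
  by_cases hdeg : G.natDegree = 0
  · obtain ⟨c, rfl⟩ := natDegree_eq_zero.1 hdeg
    refine ⟨C √|c|, by simp, fun w _ => ?_⟩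
    rw [aeval_C, Complex.coe_algebraMap, Complex.norm_real, eval_C,
      Real.norm_of_nonneg (Real.sqrt_nonneg _), Real.sq_sqrt (abs_nonneg c)]
  obtain ⟨z, hz⟩ : ∃ z : ℂ, aeval z G = 0 := by
    have : (G.map (algebraMap ℝ ℂ)).degree ≠ 0 := by
      rw [degree_map]
      intro h
      exact hdeg (natDegree_eq_of_degree_eq_some h)
    obtain ⟨z, hz⟩ := IsAlgClosed.exists_root _ this
    exact ⟨z, by rwa [IsRoot.def, eval_map_algebraMap] at hz⟩
  obtain ⟨P, hP, Q₁, hQ₁, hQ₁e, K, rfl⟩ : ∃ P : ℝ[X], 0 < P.natDegree ∧ ∃ Q : ℝ[X],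
      Q.natDegree ≤ P.natDegree ∧
      (∀ w : ℂ, ‖w‖ = 1 → ‖aeval w Q‖ ^ 2 = |P.eval w.re|) ∧ P ∣ G := by
    by_cases him : z.im = 0
    · have hzr : z = (z.re : ℂ) := Complex.ext rfl (by simp [him])
      have hr : G.eval z.re = 0 := by
        rw [hzr, ← Complex.coe_algebraMap, aeval_algebraMap_apply] at hz
        simpa using hz
      have hr1 : 1 < |z.re| := by
        by_contra h
        exact hG _ (abs_le.1 (not_lt.1 h)) hr
      obtain ⟨Q, h1, h2⟩ := exists_norm_sq_eq_abs_sub hr1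
      exact ⟨X - C z.re, by simp, Q, by simpa using h1, by simpa using h2, dvd_iff_isRoot.2 hr⟩
    · obtain ⟨Q, h1, h2⟩ := exists_norm_sq_eq_quadratic z
      have h3 : (X ^ 2 - C (2 * z.re) * X + C (‖z‖ ^ 2) : ℝ[X]).natDegree = 2 := by
        compute_degree!
      exact ⟨_, by rw [h3]; norm_num, Q, by rwa [h3], h2,
        quadratic_dvd_of_aeval_eq_zero_im_ne_zero G hz him⟩
  have hP0 : P ≠ 0 := left_ne_zero_of_mul hG0
  have hK0 : K ≠ 0 := right_ne_zero_of_mul hG0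
  rw [natDegree_mul hP0 hK0] at hn
  obtain ⟨Q₂, hQ₂, hQ₂e⟩ := ih K.natDegree (by omega) K
    (fun x hx h => hG x hx (by rw [eval_mul, h, mul_zero])) rfl
  refine ⟨Q₁ * Q₂, natDegree_mul_le.trans (by omega), fun w hw => ?_⟩
  rw [map_mul, norm_mul, mul_pow, hQ₁e w hw, hQ₂e w hw, eval_mul, abs_mul]

theorem eq_of_eval_cos_eq {p q : ℝ[X]} (h : ∀ θ : ℝ, p.eval (Real.cos θ) = q.eval (Real.cos θ)) :
    p = q := by
  refine eq_of_infinite_eval_eq p q 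
    (Set.Infinite.mono ?_ (Set.Icc_infinite (show (-1 : ℝ) < 1 by norm_num)))
  intro x hx
  have := h (Real.arccos x)
  rwa [Real.cos_arccos hx.1 hx.2] at this

theorem coeff_U_sub_one_eq_zero {m k : ℕ} {j : ℤ} (hj : j.natAbs ≤ m) (hk : m ≤ k) :
    (Chebyshev.U ℝ (j - 1)).coeff k = 0 := by
  by_cases h : j = 0
  · simp [h, Chebyshev.U_neg_one]
  apply coeff_eq_zero_of_natDegree_lt
  rw [Chebyshev.natDegree_U]
  omega

/-- **Markov–Lukács**: a positive polynomial on `[-1, 1]` of even degree bound is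
`b² + (1 - x²) g²`. The polynomials `b` and `g` come from the Fejér–Riesz factor `Q`: up to the phase
`w ^ m`, which centres its frequencies, `Q (w)` is `b (cos θ) + i sin θ g (cos θ)`
at `w = exp (i θ)`. -/
theorem exists_sq_add_sq_eq {m : ℕ} (G : ℝ[X]) (hdeg : G.natDegree ≤ 2 * m)
    (hG : ∀ x ∈ Set.Icc (-1 : ℝ) 1, 0 < G.eval x) :
    ∃ b g : ℝ[X], b.natDegree ≤ m ∧ (∀ k, m ≤ k → g.coeff k = 0) ∧
      b ^ 2 + (1 - X ^ 2) * g ^ 2 = G := by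
  obtain ⟨Q, hQ, hQe⟩ := exists_norm_sq_eq_abs_eval G fun x hx => (hG x hx).ne'
  refine ⟨∑ k ∈ Finset.range (2 * m + 1), C (Q.coeff k) * Chebyshev.T ℝ ((k : ℤ) - m),
    ∑ k ∈ Finset.range (2 * m + 1), C (Q.coeff k) * Chebyshev.U ℝ ((k : ℤ) - m - 1), ?_, ?_, ?_⟩
  · refine natDegree_sum_le_of_forall_le _ _ fun k hk => (natDegree_C_mul_le _ _).trans ?_
    rw [Finset.mem_range] at hk
    rw [Chebyshev.natDegree_T]
    omega
  · intro k hk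
    rw [finsetSum_coeff]
    refine Finset.sum_eq_zero fun i hi => ?_
    rw [Finset.mem_range] at hi
    rw [coeff_C_mul, coeff_U_sub_one_eq_zero (m := m) (by omega) hk, mul_zero]
  · refine eq_of_eval_cos_eq fun θ => ?_
    set w := Complex.exp (θ * Complex.I) with hw
    have hwn : ‖w‖ = 1 := Complex.norm_exp_ofReal_mul_I θ
    have hwre : w.re = Real.cos θ := Complex.exp_ofReal_mul_I_re θ
    have h1 := hQe w hwn
    rw [hwre, abs_of_pos (hG _ ⟨Real.neg_one_le_cos θ, Real.cos_le_one θ⟩)] at h1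
    rw [← h1]
    have h2 : aeval w Q = Complex.exp (((m : ℝ) * θ : ℝ) * Complex.I) *
        ∑ k ∈ Finset.range (2 * m + 1),
          (Q.coeff k : ℂ) * Complex.exp (((((k : ℤ) - m : ℤ) : ℝ) * θ : ℝ) * Complex.I) := by
      rw [aeval_eq_sum_range' (n := 2 * m + 1) (by omega), Finset.mul_sum]
      refine Finset.sum_congr rfl fun k _ => ?_
      rw [mul_left_comm, ← Complex.exp_add, hw, ← Complex.exp_nat_mul, Complex.real_smul]
      congr 2
      push_cast
      ring
    rw [h2, norm_mul, Complex.norm_exp_ofReal_mul_I, one_mul, Complex.sq_norm,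
      Complex.normSq_apply, Complex.re_sum, Complex.im_sum]
    have h3 : (∑ k ∈ Finset.range (2 * m + 1),
        C (Q.coeff k) * Chebyshev.T ℝ ((k : ℤ) - m)).eval (Real.cos θ) =
        ∑ k ∈ Finset.range (2 * m + 1), ((Q.coeff k : ℂ) *
          Complex.exp (((((k : ℤ) - m : ℤ) : ℝ) * θ : ℝ) * Complex.I)).re := by
      rw [eval_finsetSum]
      refine Finset.sum_congr rfl fun k _ => ?_
      rw [eval_mul, eval_C, Chebyshev.T_real_cos, Complex.re_ofReal_mul,
        Complex.exp_ofReal_mul_I_re]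
    have h4 : (∑ k ∈ Finset.range (2 * m + 1),
        C (Q.coeff k) * Chebyshev.U ℝ ((k : ℤ) - m - 1)).eval (Real.cos θ) * Real.sin θ =
        ∑ k ∈ Finset.range (2 * m + 1), ((Q.coeff k : ℂ) *
          Complex.exp (((((k : ℤ) - m : ℤ) : ℝ) * θ : ℝ) * Complex.I)).im := by
      rw [eval_finsetSum, Finset.sum_mul]
      refine Finset.sum_congr rfl fun k _ => ?_
      rw [eval_mul, eval_C, mul_assoc, Chebyshev.U_real_cos, Complex.im_ofReal_mul,
        Complex.exp_ofReal_mul_I_im]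
      congr 3
      push_cast
      ring
    rw [← h3, ← h4]
    simp only [eval_add, eval_mul, eval_pow, eval_sub, eval_one, eval_X]
    rw [← Real.sin_sq]
    ring

/-! ### Existence of symmetric phase factors -/

/-- The matrix `diag(1, z)`. -/
noncomputable def phaseMatrix (z : ℂ) : Matrix (Fin 2) (Fin 2) ℂ := !![1, 0; 0, z]

/-- The product of the rotations `exp(i φ_j X)`, `j = 0, …, d`, later ones on the left, interleaved
with `diag(1, z), diag(1, z⁻¹), diag(1, z), …`. -/
noncomputable def alternatingProduct (z : ℂ) (φ : ℕ → ℝ) : ℕ → Matrix (Fin 2) (Fin 2) ℂ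
  | 0 => rotXMatrix (φ 0)
  | d + 1 => rotXMatrix (φ (d + 1)) * phaseMatrix (if Even d then z else z⁻¹) *
      alternatingProduct z φ d

/-- The matrix `f + i (b X + s g Y)` with the polynomials evaluated at `cos θ` and `s = sin θ`. Up to
the choice of `f`, `b` and `g`, these are the products for symmetric phase factors. -/
noncomputable def symmetricForm (f b g : ℝ[X]) (θ : ℝ) : Matrix (Fin 2) (Fin 2) ℂ :=
  !![((f.eval (Real.cos θ) : ℝ) : ℂ),
      Complex.I * ((b.eval (Real.cos θ) : ℝ) : ℂ) + (Real.sin θ : ℂ) * ((g.eval (Real.cos θ) : ℝ) : ℂ);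
    Complex.I * ((b.eval (Real.cos θ) : ℝ) : ℂ) - (Real.sin θ : ℂ) * ((g.eval (Real.cos θ) : ℝ) : ℂ),
      ((f.eval (Real.cos θ) : ℝ) : ℂ)]

theorem alternatingProduct_congr (z : ℂ) {φ ψ : ℕ → ℝ} {d : ℕ} (h : ∀ j ≤ d, φ j = ψ j) :
    alternatingProduct z φ d = alternatingProduct z ψ d := by
  induction d with
  | zero => simp [alternatingProduct, h 0 le_rfl]
  | succ d ih =>
    simp only [alternatingProduct]
    rw [ih fun j hj => h j (by omega), h _ le_rfl]

/-- Splitting off the first rotation instead of the last one. -/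
theorem alternatingProduct_succ' (z : ℂ) (φ : ℕ → ℝ) (d : ℕ) :
    alternatingProduct z φ (d + 1) =
      alternatingProduct z⁻¹ (fun j => φ (j + 1)) d * phaseMatrix z * rotXMatrix (φ 0) := by
  induction d with
  | zero => simp [alternatingProduct]
  | succ d ih =>
    rw [alternatingProduct, ih, alternatingProduct]
    have : (if Even (d + 1) then z else z⁻¹) = if Even d then z⁻¹ else z⁻¹⁻¹ := by
      by_cases h : Even d <;> simp [h, Nat.even_add_one]
    rw [this]
    simp only [Matrix.mul_assoc]

theorem alternatingProduct_two_mul_succ (z : ℂ) (φ : ℕ → ℝ) (m : ℕ) :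
    alternatingProduct z φ (2 * (m + 1)) = rotXMatrix (φ (2 * (m + 1))) * phaseMatrix z⁻¹ *
      alternatingProduct z⁻¹ (fun j => φ (j + 1)) (2 * m) * phaseMatrix z * rotXMatrix (φ 0) := by
  rw [show 2 * (m + 1) = 2 * m + 1 + 1 by ring, alternatingProduct, alternatingProduct_succ']
  simp [Matrix.mul_assoc]

theorem exists_cos_sin_two_mul {c s : ℝ} (h : c ^ 2 + s ^ 2 = 1) :
    ∃ α : ℝ, Real.cos (2 * α) = c ∧ Real.sin (2 * α) = s := by
  have hn : ‖(⟨c, s⟩ : ℂ)‖ = 1 := by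
    rw [← sq_eq_sq₀ (norm_nonneg _) zero_le_one, Complex.sq_norm, Complex.normSq_apply]
    simp only
    linarith
  have h0 : (⟨c, s⟩ : ℂ) ≠ 0 := norm_ne_zero_iff.1 (by rw [hn]; exact one_ne_zero)
  refine ⟨Complex.arg ⟨c, s⟩ / 2, ?_, ?_⟩
  · rw [mul_div_cancel₀ _ two_ne_zero, Complex.cos_arg h0, hn, div_one]
  · rw [mul_div_cancel₀ _ two_ne_zero, Complex.sin_arg, hn, div_one]

/-- Multiplication by equal rotations on both sides rotates the pair `(f, b)`. -/
theorem rotXMatrix_mul_symmetricForm (f b g : ℝ[X]) (α θ : ℝ) :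
    rotXMatrix α * symmetricForm (C (Real.cos (2 * α)) * f + C (Real.sin (2 * α)) * b)
      (C (Real.cos (2 * α)) * b - C (Real.sin (2 * α)) * f) g θ * rotXMatrix α =
      symmetricForm f b g θ := by
  have hα : (Complex.cos α) ^ 2 + (Complex.sin α) ^ 2 = 1 := Complex.cos_sq_add_sin_sq _
  have hI : Complex.I ^ 2 = -1 := Complex.I_sq
  ext i j
  fin_cases i <;> fin_cases j <;>
  simp [rotXMatrix, symmetricForm, Matrix.mul_apply, Fin.sum_univ_two, Complex.cos_two_mul',
    Complex.sin_two_mul] <;>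
  generalize ((eval (Real.cos θ) f : ℝ) : ℂ) = F <;>
  generalize ((eval (Real.cos θ) b : ℝ) : ℂ) = B <;>
  generalize ((eval (Real.cos θ) g : ℝ) : ℂ) = G <;> generalize Complex.sin θ = S <;>
  generalize Complex.cos α = c at * <;> generalize Complex.sin α = s at *
  · linear_combination (s ^ 2 * ((c ^ 2 - s ^ 2) * F + 2 * s * c * B) +
      2 * s * c * ((c ^ 2 - s ^ 2) * B - 2 * s * c * F)) * hI + F * (c ^ 2 + s ^ 2 + 1) * hα
  · linear_combination (Complex.I * s ^ 2 * ((c ^ 2 - s ^ 2) * B - 2 * s * c * F) -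
      s ^ 2 * S * G) * hI + (Complex.I * B * (c ^ 2 + s ^ 2 + 1) + S * G) * hα
  · linear_combination (Complex.I * s ^ 2 * ((c ^ 2 - s ^ 2) * B - 2 * s * c * F) +
      s ^ 2 * S * G) * hI + (Complex.I * B * (c ^ 2 + s ^ 2 + 1) - S * G) * hα
  · linear_combination (s ^ 2 * ((c ^ 2 - s ^ 2) * F + 2 * s * c * B) +
      2 * s * c * ((c ^ 2 - s ^ 2) * B - 2 * s * c * F)) * hI + F * (c ^ 2 + s ^ 2 + 1) * hα

/-- Conjugation by `diag(1, exp(i θ))` multiplies `b + i s g` by `exp(i θ)`. -/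
theorem phaseMatrix_mul_symmetricForm (f g₁ g₂ : ℝ[X]) (θ : ℝ) :
    phaseMatrix (Complex.exp (-(θ * Complex.I)))⁻¹ * symmetricForm f (X * g₂ + g₁) g₂ (-θ) *
      phaseMatrix (Complex.exp (-(θ * Complex.I))) = symmetricForm f (g₂ + X * g₁) g₁ θ := by
  have hc : (Complex.cos θ) ^ 2 + (Complex.sin θ) ^ 2 = 1 := Complex.cos_sq_add_sin_sq _
  have hI : Complex.I ^ 2 = -1 := Complex.I_sq
  rw [← Complex.exp_neg, neg_neg, ← neg_mul, Complex.exp_mul_I, Complex.exp_mul_I, Complex.cos_neg,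
    Complex.sin_neg]
  ext i j
  fin_cases i <;> fin_cases j <;>
  simp [phaseMatrix, symmetricForm, Matrix.mul_apply, Fin.sum_univ_two] <;>
  generalize ((eval (Real.cos θ) g₁ : ℝ) : ℂ) = G <;> generalize ((eval (Real.cos θ) g₂ : ℝ) : ℂ) = H <;>
  generalize Complex.sin θ = s at * <;>
  generalize Complex.cos θ = c at *
  · linear_combination Complex.I * H * hc - (c * H * s + G * s) * hI
  · linear_combination Complex.I * H * hc + (c * H * s + G * s) * hI
  · linear_combination ((eval (Real.cos θ) f : ℝ) : ℂ) * (hc - s ^ 2 * hI)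

theorem natDegree_sub_le_of_degree_le {p q : ℝ[X]} {n : ℕ} (hp : p.natDegree ≤ n)
    (hq : q.natDegree ≤ n) : (p - q).natDegree ≤ n :=
  (natDegree_sub_le_of_le hp hq).trans (max_self n).le

/-- Existence of phase factors by stripping layers. After a rotation the leading coefficient
of `f` vanishes and those of `b` and `x g` agree; the normalization then
forces the next coefficients of `b` and `x g` to agree too, so that undoing the outermost pair of
evolutions lowers the degree. -/
theorem exists_phases_of_sq_add_sq_eq_one (m : ℕ) (f b g : ℝ[X]) (hf : f.natDegree ≤ m)
    (hb : b.natDegree ≤ m) (hg : ∀ k, m ≤ k → g.coeff k = 0)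
    (h : f ^ 2 + b ^ 2 + (1 - X ^ 2) * g ^ 2 = 1) :
    ∃ P : Phases, P.m ≤ m ∧ ∀ θ : ℝ,
      alternatingProduct (Complex.exp (-(θ * Complex.I))) P.φ (2 * P.m) =
        symmetricForm f b g θ := by
  induction m generalizing f b g with
  | zero =>
    obtain rfl : g = 0 := by ext k; simpa using hg k (Nat.zero_le k)
    obtain ⟨c, rfl⟩ := natDegree_eq_zero.1 (Nat.le_zero.1 hf)
    obtain ⟨s, rfl⟩ := natDegree_eq_zero.1 (Nat.le_zero.1 hb)
    have h1 : c ^ 2 + s ^ 2 = 1 := by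
      have := congrArg (eval 0) h
      simpa using this
    obtain ⟨α, h2, h3⟩ := exists_cos_sin_two_mul h1
    refine ⟨⟨0, fun _ => 2 * α, fun _ _ => rfl⟩, le_rfl, fun θ => ?_⟩
    simp only [alternatingProduct, mul_zero, rotXMatrix, symmetricForm, h2, h3]
    simp
  | succ m ih =>
    have hgd : g.natDegree ≤ m := natDegree_le_iff_coeff_eq_zero.2 fun k hk => hg k hk
    have hXg : (X * g).natDegree ≤ m + 1 := natDegree_mul_le.trans (by rw [natDegree_X]; omega)
    have hsplit (f b : ℝ[X]) (h : f ^ 2 + b ^ 2 + (1 - X ^ 2) * g ^ 2 = 1) :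
        f * f + (b - X * g) * (b + X * g) + g * g = 1 := by linear_combination h
    have htop : f.coeff (m + 1) ^ 2 + b.coeff (m + 1) ^ 2 = g.coeff m ^ 2 := by
      have h1 := congrArg (fun p => coeff p (m + 1 + (m + 1))) (hsplit f b h)
      simp only [coeff_add] at h1
      rw [coeff_mul_add_eq_of_natDegree_le hf hf,
        coeff_mul_add_eq_of_natDegree_le (natDegree_sub_le_of_degree_le hb hXg) (natDegree_add_le_of_degree_le hb hXg),
        coeff_mul_add_eq_of_natDegree_le (hgd.trans (Nat.le_succ m)) (hgd.trans (Nat.le_succ m)),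
        coeff_one, if_neg (by omega), hg (m + 1) le_rfl, coeff_sub, coeff_add, coeff_X_mul] at h1
      linear_combination h1
    by_cases hg0 : g.coeff m = 0
    · rw [hg0] at htop
      obtain ⟨P, hP, hPe⟩ := ih f b g
        (natDegree_le_pred hf (by nlinarith)) (natDegree_le_pred hb (by nlinarith))
        (fun k hk => (Nat.lt_or_eq_of_le hk).elim (fun h => hg k h) (fun h => h ▸ hg0)) h
      exact ⟨P, hP.trans (Nat.le_succ m), hPe⟩
    obtain ⟨α, hc, hs⟩ := exists_cos_sin_two_mul (c := b.coeff (m + 1) / g.coeff m)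
      (s := -f.coeff (m + 1) / g.coeff m) (by field_simp; linarith)
    set f' := C (Real.cos (2 * α)) * f + C (Real.sin (2 * α)) * b with hf'
    set b' := C (Real.cos (2 * α)) * b - C (Real.sin (2 * α)) * f with hb'
    have hf'd : f'.natDegree ≤ m := by
      refine natDegree_le_pred (n := m + 1) (natDegree_add_le_of_degree_le
        ((natDegree_C_mul_le _ _).trans hf) ((natDegree_C_mul_le _ _).trans hb)) ?_
      rw [coeff_add, coeff_C_mul, coeff_C_mul, hc, hs]
      field_simp
      ring
    have hb'd : b'.natDegree ≤ m + 1 := natDegree_sub_le_of_degree_le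
        ((natDegree_C_mul_le _ _).trans hb) ((natDegree_C_mul_le _ _).trans hf)
    have hb'c : b'.coeff (m + 1) = g.coeff m := by
      rw [coeff_sub, coeff_C_mul, coeff_C_mul, hc, hs]
      field_simp
      linarith
    have hnorm : f' ^ 2 + b' ^ 2 + (1 - X ^ 2) * g ^ 2 = 1 := by
      have h1 : (C (Real.cos (2 * α)) : ℝ[X]) ^ 2 + C (Real.sin (2 * α)) ^ 2 = 1 := by
        rw [← C_pow, ← C_pow, ← C_add, Real.cos_sq_add_sin_sq, C_1]
      rw [hf', hb']
      linear_combination h + (f ^ 2 + b ^ 2) * h1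
    set g' := b' - X * g with hg'
    have hg'd : g'.natDegree ≤ m := by
      refine natDegree_le_pred (n := m + 1) (natDegree_sub_le_of_degree_le hb'd hXg) ?_
      rw [coeff_sub, coeff_X_mul, hb'c, sub_self]
    have hg'c : g'.coeff m = 0 := by
      have h1 := congrArg (fun p => coeff p (m + (m + 1))) (hsplit f' b' hnorm)
      simp only [coeff_add] at h1
      rw [coeff_mul_add_eq_of_natDegree_le hf'd (hf'd.trans (Nat.le_succ m)),
        coeff_mul_add_eq_of_natDegree_le hg'd (natDegree_add_le_of_degree_le hb'd hXg),
        coeff_mul_add_eq_of_natDegree_le hgd (hgd.trans (Nat.le_succ m)),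
        coeff_one, if_neg (by omega), hg (m + 1) le_rfl, coeff_add b', coeff_X_mul, hb'c,
        coeff_eq_zero_of_natDegree_lt (p := f') (Nat.lt_succ_of_le hf'd)] at h1
      have h2 : g'.coeff m * g.coeff m = 0 := by linear_combination h1 / 2
      exact (mul_eq_zero.1 h2).resolve_right hg0
    have hg'0 : ∀ k, m ≤ k → g'.coeff k = 0 := fun k hk => (Nat.lt_or_eq_of_le hk).elim
      (fun h => coeff_eq_zero_of_natDegree_lt (hg'd.trans_lt h)) (fun h => h ▸ hg'c)
    have hXg' : (X * g' + g).natDegree ≤ m := by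
      refine natDegree_le_iff_coeff_eq_zero.2 fun k hk => ?_
      obtain ⟨k, rfl⟩ : ∃ j, k = j + 1 := ⟨k - 1, by omega⟩
      rw [coeff_add, coeff_X_mul, hg'0 k (by omega), hg _ (by omega), add_zero]
    obtain ⟨P, hP, hPe⟩ := ih f' (X * g' + g) g' hf'd hXg' hg'0
      (by rw [hg']; linear_combination hnorm)
    refine ⟨⟨P.m + 1, fun j => if j = 0 ∨ j = 2 * (P.m + 1) then α else P.φ (j - 1), ?_⟩,
      Nat.succ_le_succ hP, fun θ => ?_⟩
    · intro j hj
      by_cases h1 : j = 0 ∨ j = 2 * (P.m + 1)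
      · rw [if_pos h1, if_pos (by omega)]
      · rw [if_neg h1, if_neg (by omega), P.symm _ (by omega)]
        congr 1
        omega
    · simp only
      rw [alternatingProduct_two_mul_succ, alternatingProduct_congr (ψ := P.φ)]
      · have h1 := hPe (-θ)
        rw [Complex.ofReal_neg, neg_mul, neg_neg, ← neg_neg ((θ : ℂ) * Complex.I), Complex.exp_neg]
          at h1
        have h2 := phaseMatrix_mul_symmetricForm f' g g' θ
        rw [show g' + X * g = b' by rw [hg']; ring] at h2
        rw [h1, if_pos (Or.inr rfl), if_pos (Or.inl rfl), Matrix.mul_assoc (rotXMatrix α),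
          Matrix.mul_assoc (rotXMatrix α), h2, rotXMatrix_mul_symmetricForm]
      · intro j hj
        rw [if_neg (by omega), Nat.add_sub_cancel]

/-- A polynomial that is less than one in modulus on `[-1, 1]` is the upper left entry of the product
for suitable symmetric phase factors. -/
theorem exists_phases (m : ℕ) (f : ℝ[X]) (hf : f.natDegree ≤ m)
    (hf1 : ∀ x ∈ Set.Icc (-1 : ℝ) 1, |f.eval x| < 1) :
    ∃ P : Phases, P.m ≤ m ∧ ∀ θ : ℝ,
      alternatingProduct (Complex.exp (-(θ * Complex.I))) P.φ (2 * P.m) 0 0 =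
        ((f.eval (Real.cos θ) : ℝ) : ℂ) := by
  obtain ⟨b, g, hb, hg, h⟩ := exists_sq_add_sq_eq (m := m) (1 - f ^ 2)
    (natDegree_sub_le_of_degree_le (by simp) (natDegree_pow_le_of_le 2 hf)) (fun x hx => by
      have := (sq_lt_one_iff_abs_lt_one _).2 (hf1 x hx)
      simpa using this)
  obtain ⟨P, hP, hPe⟩ := exists_phases_of_sq_add_sq_eq_one m f b g hf hb hg
    (by linear_combination h)
  exact ⟨P, hP, fun θ => by rw [hPe]; simp [symmetricForm]⟩

/-! ### Filter polynomials -/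

/-- The Fejér kernel `(1 - cos n x) / (1 - cos x)`, as a polynomial in `cos x`. -/
theorem exists_fejer_polynomial (n : ℕ) :
    ∃ E : ℝ[X], E.natDegree ≤ n ∧
      ∀ x : ℝ, (1 - Real.cos x) * E.eval (Real.cos x) = 1 - Real.cos (n * x) := by
  obtain ⟨E, hE⟩ : (X - C 1 : ℝ[X]) ∣ Chebyshev.T ℝ (n : ℤ) - 1 :=
    dvd_iff_isRoot.2 (by simp)
  refine ⟨E, ?_, fun x => ?_⟩
  · by_cases h0 : E = 0
    · simp [h0]
    have h1 := natDegree_mul (X_sub_C_ne_zero (1 : ℝ)) h0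
    rw [← hE] at h1
    have h2 : (Chebyshev.T ℝ (n : ℤ) - 1).natDegree ≤ n :=
      natDegree_sub_le_of_degree_le (by rw [Chebyshev.natDegree_T]; simp) (by simp)
    omega
  · have h1 := congrArg (eval (Real.cos x)) hE
    simp only [eval_sub, eval_one, eval_mul, eval_X, eval_C, Chebyshev.T_real_cos] at h1
    push_cast at h1
    linarith

theorem integral_eq_zero_of_odd {f : ℝ → ℝ} (hf : ∀ x, f (-x) = -f x) (c : ℝ) :
    ∫ y in (-c)..c, f y = 0 := by
  have h := intervalIntegral.integral_comp_neg (a := -c) (b := c) f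
  simp only [hf, intervalIntegral.integral_neg, neg_neg] at h
  linarith

/-- Convolving a polynomial in the cosine with the indicator function of a symmetric interval gives a
polynomial in the cosine of no larger degree. -/
theorem exists_polynomial_eq_integral (k : ℝ[X]) (c : ℝ) :
    ∃ F : ℝ[X], F.natDegree ≤ k.natDegree ∧
      ∀ θ : ℝ, F.eval (Real.cos θ) = ∫ y in (-c)..c, k.eval (Real.cos (θ - y)) := by
  have hpow (l : ℕ) : ∃ F : ℝ[X], F.natDegree ≤ l ∧
      ∀ θ : ℝ, F.eval (Real.cos θ) = ∫ y in (-c)..c, Real.cos (θ - y) ^ l := by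
    refine ⟨∑ i ∈ Finset.range (l + 1),
      C ((∫ y in (-c)..c, Real.cos y ^ i * Real.sin y ^ (l - i)) * (l.choose i : ℝ)) *
        (X ^ i * (1 - X ^ 2) ^ ((l - i) / 2)), ?_, fun θ => ?_⟩
    · refine natDegree_sum_le_of_forall_le _ _ fun i hi => (natDegree_C_mul_le _ _).trans ?_
      have h1 : (1 - X ^ 2 : ℝ[X]).natDegree ≤ 2 :=
        natDegree_sub_le_of_degree_le (by simp) (by simp)
      refine natDegree_mul_le.trans ?_
      have h2 := natDegree_pow_le_of_le ((l - i) / 2) h1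
      rw [Finset.mem_range] at hi
      rw [natDegree_X_pow]
      omega
    · have h1 (y : ℝ) : Real.cos (θ - y) ^ l = ∑ i ∈ Finset.range (l + 1),
          Real.cos θ ^ i * Real.sin θ ^ (l - i) * (l.choose i : ℝ) *
            (Real.cos y ^ i * Real.sin y ^ (l - i)) := by
        rw [Real.cos_sub, add_pow]
        refine Finset.sum_congr rfl fun i _ => ?_
        rw [mul_pow, mul_pow]
        ring
      simp_rw [h1]
      rw [intervalIntegral.integral_finsetSum
        (fun i _ => (by fun_prop : Continuous _).intervalIntegrable _ _), eval_finsetSum]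
      refine Finset.sum_congr rfl fun i _ => ?_
      rw [intervalIntegral.integral_const_mul]
      simp only [eval_mul, eval_C, eval_pow, eval_X, eval_sub, eval_one]
      rcases Nat.even_or_odd (l - i) with ⟨e, he⟩ | hodd
      · rw [← Real.sin_sq, he, ← two_mul, Nat.mul_div_cancel_left _ two_pos, ← pow_mul]
        ring
      · rw [integral_eq_zero_of_odd (fun x => by
          rw [Real.cos_neg, Real.sin_neg, hodd.neg_pow, mul_neg])]
        ring
  choose F hF hFe using hpow
  refine ⟨∑ l ∈ Finset.range (k.natDegree + 1), C (k.coeff l) * F l, ?_, fun θ => ?_⟩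
  · refine natDegree_sum_le_of_forall_le _ _ fun l hl => (natDegree_C_mul_le _ _).trans ?_
    rw [Finset.mem_range] at hl
    exact (hF l).trans (by omega)
  · simp_rw [eval_eq_sum_range]
    rw [intervalIntegral.integral_finsetSum
        (fun i _ => (by fun_prop : Continuous _).intervalIntegrable _ _), ← eval_eq_sum_range,
        eval_finsetSum]
    refine Finset.sum_congr rfl fun i _ => ?_
    rw [intervalIntegral.integral_const_mul, eval_mul, eval_C, hFe]

theorem one_sub_cos_ge {x : ℝ} (hx : |x| ≤ Real.pi) : 2 / Real.pi ^ 2 * x ^ 2 ≤ 1 - Real.cos x := by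
  have := Real.cos_le_one_sub_mul_cos_sq hx
  linarith

theorem cos_le_cos_of_mem {h x : ℝ} (h0 : 0 ≤ h) (hx : h ≤ x) (hx' : x ≤ 2 * Real.pi - h) :
    Real.cos x ≤ Real.cos h := by
  rcases le_total x Real.pi with h1 | h1
  · exact Real.cos_le_cos_of_nonneg_of_le_pi h0 h1 hx
  · rw [← Real.cos_two_pi_sub x]
    exact Real.cos_le_cos_of_nonneg_of_le_pi h0 (by linarith) (by linarith)

/-- A filter with transition region `[θa, θb]`: the indicator function of `|θ| ≤ (θa + θb) / 2`, convolved
with the normalized `2 r`-th power of the Fejér kernel. The exponent is even so that the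
power is evidently nonnegative. -/
theorem exists_filter_of_pow_le {θa θb η : ℝ} (ha : 0 ≤ θa) (hab : θa < θb) (hb : θb ≤ Real.pi)
    (n r : ℕ) (hn : 0 < n)
    (hη : 4 * n * (Real.pi ^ 4 / (n ^ 2 * (θb - θa) ^ 2)) ^ (2 * r) ≤ η) :
    ∃ F : ℝ[X], F.natDegree ≤ n * (2 * r) ∧
      (∀ θ, 0 ≤ F.eval (Real.cos θ) ∧ F.eval (Real.cos θ) ≤ 1) ∧
      (∀ θ, 0 ≤ θ → θ ≤ θa → 1 - η ≤ F.eval (Real.cos θ)) ∧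
      (∀ θ, θb ≤ θ → θ ≤ Real.pi → F.eval (Real.cos θ) ≤ η) := by
  obtain ⟨E, hEd, hE⟩ := exists_fejer_polynomial n
  have hπ := Real.pi_pos
  have hn' : (0 : ℝ) < n := Nat.cast_pos.2 hn
  set c := (θa + θb) / 2 with hc
  set h := (θb - θa) / 2 with hh
  have h0 : 0 < h := by rw [hh]; linarith
  set K : ℝ → ℝ := fun x => E.eval (Real.cos x) ^ (2 * r) with hK
  have hKc : Continuous K := by rw [hK]; fun_prop
  have hKi (a b : ℝ) : IntervalIntegrable K volume a b := hKc.intervalIntegrable a b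
  have hK0 (x : ℝ) : 0 ≤ K x := by simp only [hK, pow_mul]; positivity
  have hKp : Function.Periodic K (2 * Real.pi) := fun x => by simp only [hK, Real.cos_add_two_pi]
  -- The kernel is small away from the multiples of `2 π`.
  set B := (Real.pi ^ 2 / h ^ 2) ^ (2 * r) with hB
  have hE0 (x : ℝ) (hx : Real.cos x < 1) : 0 ≤ E.eval (Real.cos x) :=
    nonneg_of_mul_nonneg_right ((hE x).symm ▸ sub_nonneg.2 (Real.cos_le_one _)) (sub_pos.2 hx)
  have hKB (x : ℝ) (hx : h ≤ x) (hx' : x ≤ 2 * Real.pi - h) : K x ≤ B := by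
    have h1 : 2 / Real.pi ^ 2 * h ^ 2 ≤ 1 - Real.cos x :=
      (one_sub_cos_ge (by rw [abs_of_pos h0, hh]; linarith)).trans
        (by linarith [cos_le_cos_of_mem h0.le hx hx'])
    have h2 : 0 < 2 / Real.pi ^ 2 * h ^ 2 := by positivity
    have h3 := hE0 x (by linarith)
    refine pow_le_pow_left₀ h3 ?_ _
    have h4 : 2 / Real.pi ^ 2 * h ^ 2 * E.eval (Real.cos x) ≤ 2 :=
      (mul_le_mul_of_nonneg_right h1 h3).trans
        (by rw [hE]; linarith [Real.neg_one_le_cos (n * x)])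
    rw [le_div_iff₀ (by positivity)]
    have h5 : 2 / Real.pi ^ 2 * h ^ 2 * E.eval (Real.cos x) * Real.pi ^ 2 =
      2 * (E.eval (Real.cos x) * h ^ 2) := by field_simp
    nlinarith [mul_le_mul_of_nonneg_right h4 (sq_nonneg Real.pi)]
  have hint (a b : ℝ) (hab : a ≤ b) (hba : b - a ≤ 2 * Real.pi) (h1 : h ≤ a)
      (h2 : b ≤ 2 * Real.pi - h) : ∫ y in a..b, K y ≤ 2 * Real.pi * B := by
    calc ∫ y in a..b, K y ≤ ∫ _ in a..b, B :=
          intervalIntegral.integral_mono_on hab (hKi _ _) (by simp)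
            fun x hx => hKB x (h1.trans hx.1) (hx.2.trans h2)
      _ = (b - a) * B := by simp
      _ ≤ _ := mul_le_mul_of_nonneg_right hba (by rw [hB]; positivity)
  -- The mass of the kernel near zero.
  set S := ∫ y in (-Real.pi)..Real.pi, K y with hS
  have hperiod (a : ℝ) : ∫ y in a..(a + 2 * Real.pi), K y = S := by
    rw [hKp.intervalIntegral_add_eq a (-Real.pi), hS]
    congr 1
    ring
  have hSge : Real.pi / (2 * n) * (4 * n ^ 2 / Real.pi ^ 2) ^ (2 * r) ≤ S := by
    have h1 : Real.pi / (2 * n) ≤ Real.pi / n :=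
      div_le_div_of_nonneg_left hπ.le hn' (by linarith)
    have h2 : Real.pi / n ≤ Real.pi := div_le_self hπ.le (Nat.one_le_cast.2 hn)
    have h3 : 0 < Real.pi / (2 * n) := by positivity
    have h4 : ∫ _ in (Real.pi / (2 * n))..(Real.pi / n),
        (4 * (n : ℝ) ^ 2 / Real.pi ^ 2) ^ (2 * r) ≤ ∫ y in (Real.pi / (2 * n))..(Real.pi / n), K y := by
      refine intervalIntegral.integral_mono_on h1 (by simp) (hKi _ _) fun x hx => ?_
      refine pow_le_pow_left₀ (by positivity) ?_ _
      have hx0 : 0 < x := h3.trans_le hx.1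
      have hnx : n * x ≤ Real.pi := by
        have := (le_div_iff₀ hn').1 hx.2
        linarith
      have h5 := one_sub_cos_ge (x := n * x) (by rwa [abs_of_pos (by positivity)])
      have h6 := Real.one_sub_sq_div_two_le_cos (x := x)
      have h7 : Real.cos x < 1 := by
        have := one_sub_cos_ge (x := x) (by rw [abs_of_pos hx0]; exact hx.2.trans h2)
        have : 0 < 2 / Real.pi ^ 2 * x ^ 2 := by positivity
        linarith
      rw [← hE] at h5
      have h8 : (1 - Real.cos x) * E.eval (Real.cos x) ≤ x ^ 2 / 2 * E.eval (Real.cos x) :=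
        mul_le_mul_of_nonneg_right (by linarith) (hE0 x h7)
      have h9 := h5.trans h8
      have h10 : x ^ 2 / 2 * (4 * n ^ 2 / Real.pi ^ 2) ≤ x ^ 2 / 2 * E.eval (Real.cos x) :=
        le_trans (le_of_eq (by ring)) h9
      exact le_of_mul_le_mul_left h10 (by positivity)
    have h5 : ∫ y in (Real.pi / (2 * n))..(Real.pi / n), K y ≤ S :=
      intervalIntegral.integral_mono_interval (by linarith) h1 h2
        (Filter.Eventually.of_forall hK0) (hKi _ _)
    refine le_trans (le_of_eq ?_) (h4.trans h5)
    rw [intervalIntegral.integral_const, smul_eq_mul]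
    congr 1
    field_simp
    ring
  have hSpos : 0 < S := lt_of_lt_of_le (by positivity) hSge
  have hBS : 2 * Real.pi * B ≤ η * S := by
    refine le_trans ?_ (mul_le_mul hη hSge (by positivity)
      (le_trans (by positivity) hη))
    rw [hB]
    have h1 : Real.pi ^ 2 / h ^ 2 = Real.pi ^ 4 / (n ^ 2 * (θb - θa) ^ 2) *
        (4 * n ^ 2 / Real.pi ^ 2) := by
      have : θb - θa ≠ 0 := by linarith
      rw [hh]
      field_simp
      norm_num
    rw [h1, mul_pow]
    refine le_of_eq ?_
    field_simp
    ring
  -- Convolution with the indicator function.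
  obtain ⟨F, hFd, hF⟩ := exists_polynomial_eq_integral (E ^ (2 * r)) c
  have hF' (θ : ℝ) : F.eval (Real.cos θ) = ∫ y in (θ - c)..(θ + c), K y := by
    rw [hF]
    simp only [eval_pow]
    rw [intervalIntegral.integral_comp_sub_left (fun y => E.eval (Real.cos y) ^ (2 * r))]
    simp [hK]
  have hcompl (θ : ℝ) : F.eval (Real.cos θ) + ∫ y in (θ + c)..(θ - c + 2 * Real.pi), K y = S := by
    rw [hF', intervalIntegral.integral_add_adjacent_intervals (hKi _ _) (hKi _ _), hperiod]
  have hcπ : c ≤ Real.pi := by rw [hc]; linarith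
  refine ⟨C S⁻¹ * F, (natDegree_C_mul_le _ _).trans (hFd.trans ?_), fun θ => ?_, fun θ h1 h2 => ?_,
    fun θ h1 h2 => ?_⟩
  · rw [mul_comm n]
    exact natDegree_pow_le_of_le _ hEd
  · rw [eval_mul, eval_C, inv_mul_eq_div]
    constructor
    · refine div_nonneg ?_ hSpos.le
      rw [hF']
      exact intervalIntegral.integral_nonneg (by rw [hc]; linarith) fun y _ => hK0 y
    · rw [div_le_one hSpos, ← hcompl θ]
      exact le_add_of_nonneg_right
        (intervalIntegral.integral_nonneg (by linarith) fun y _ => hK0 y)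
  · rw [eval_mul, eval_C, inv_mul_eq_div, le_div_iff₀ hSpos]
    have h3 := hint (θ + c) (θ - c + 2 * Real.pi) (by linarith) (by rw [hc]; linarith)
      (by rw [hc, hh]; linarith) (by rw [hc, hh]; linarith)
    linarith [hcompl θ]
  · rw [eval_mul, eval_C, inv_mul_eq_div, div_le_iff₀ hSpos, hF']
    exact (hint _ _ (by rw [hc]; linarith) (by linarith) (by rw [hc, hh]; linarith)
      (by rw [hc, hh]; linarith)).trans hBS

/-- The QETU circuit with phase factors `P` passes angles in `[0, θa]`, stops angles in `[θb, π]`, both up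
to an error of order `η`, and multiplies the amplitude by a factor in `[0, 1]` at every
angle. -/
def Phases.IsFilter (P : Phases) (θa θb η : ℝ) : Prop :=
  ∃ F : ℝ → ℝ,
    (∀ θ : ℝ, alternatingProduct (Complex.exp (-(θ * Complex.I))) P.φ (2 * P.m) 0 0 =
      (F (Real.cos θ) : ℂ)) ∧
    (∀ θ, 0 ≤ F (Real.cos θ) ∧ F (Real.cos θ) ≤ 1) ∧
    (∀ θ, 0 ≤ θ → θ ≤ θa → 1 - 2 * η ≤ F (Real.cos θ)) ∧
    (∀ θ, θb ≤ θ → θ ≤ Real.pi → F (Real.cos θ) ≤ η)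

/-- Phase factors of an approximate step function. The degree is inversely proportional to the width
of the transition region, up to a logarithm. The filter is scaled by `1 - η` to be
strictly less than one. -/
theorem exists_phases_filter {θa θb η : ℝ} (ha : 0 ≤ θa) (hab : θa < θb) (hb : θb ≤ Real.pi)
    (hη : 0 < η) (hη1 : η < 1) :
    ∃ P : Phases, (P.m : ℝ) ≤ 62 / (θb - θa) * Real.log (124 / ((θb - θa) * η)) ∧
      P.IsFilter θa θb η := by
  set w := θb - θa with hw
  have hw0 : 0 < w := sub_pos.2 hab
  have hw4 : w < 4 := by linarith [Real.pi_lt_four]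
  set n := ⌈27 / w⌉₊ with hn
  have hn1 : 27 / w ≤ n := Nat.le_ceil _
  have hn2 : (n : ℝ) ≤ 31 / w := by
    refine (Nat.ceil_lt_add_one (by positivity)).le.trans ?_
    rw [div_add_one hw0.ne']
    gcongr
    linarith
  have hn' : (0 : ℝ) < n := lt_of_lt_of_le (by positivity) hn1
  set r := ⌈Real.log (4 * n / η) / 4⌉₊ with hr
  set l := Real.log (124 / (w * η)) with hl
  have hle : 4 * n / η ≤ 124 / (w * η) := by
    rw [← div_div]
    gcongr
    calc 4 * (n : ℝ) ≤ 4 * (31 / w) := by gcongr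
      _ = 124 / w := by ring
  have hl3 : 3 ≤ l := by
    rw [hl, Real.le_log_iff_exp_le (by positivity)]
    have h1 : Real.exp 3 ≤ 31 := by
      rw [show (3 : ℝ) = 1 + 1 + 1 by norm_num, Real.exp_add, Real.exp_add]
      have := Real.exp_one_lt_d9
      have h0 := Real.exp_pos 1
      have h2 : Real.exp 1 * Real.exp 1 ≤ 2.72 * 2.72 := by gcongr <;> linarith
      have h3 : Real.exp 1 * Real.exp 1 * Real.exp 1 ≤ 2.72 * 2.72 * 2.72 := by
        gcongr; linarith
      linarith
    refine h1.trans ?_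
    rw [le_div_iff₀ (by positivity)]
    have : w * η ≤ 4 * 1 := by gcongr
    linarith
  have hlog : Real.log (4 * n / η) ≤ l := Real.log_le_log (by positivity) hle
  have hlog0 : 0 ≤ Real.log (4 * n / η) := by
    apply Real.log_nonneg
    rw [le_div_iff₀ hη]
    have : (1 : ℝ) ≤ n := by exact_mod_cast Nat.cast_pos.1 hn'
    linarith
  have hr2 : 2 * (r : ℝ) ≤ 2 * l := by
    have := (Nat.ceil_lt_add_one (a := Real.log (4 * n / η) / 4) (by positivity)).le
    rw [← hr] at this
    linarith
  have hdecay : 4 * n * (Real.pi ^ 4 / (n ^ 2 * w ^ 2)) ^ (2 * r) ≤ η := by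
    have h1 : Real.pi ^ 4 / (n ^ 2 * w ^ 2) ≤ Real.exp (-2) := by
      have h27 : 27 ≤ n * w := (div_le_iff₀ hw0).1 hn1
      have h2 : (27 : ℝ) ^ 2 ≤ n ^ 2 * w ^ 2 := by
        rw [← mul_pow]; exact pow_le_pow_left₀ (by norm_num) h27 2
      have h3 : Real.pi ^ 4 ≤ 3.1416 ^ 4 :=
        pow_le_pow_left₀ Real.pi_pos.le Real.pi_lt_d4.le 4
      have h4 : Real.exp 2 ≤ 2.7182818286 ^ 2 := by
        rw [show (2 : ℝ) = 1 + 1 by norm_num, Real.exp_add, pow_two]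
        have := Real.exp_one_lt_d9.le
        gcongr
      rw [Real.exp_neg, div_le_iff₀ (by positivity), inv_mul_eq_div, le_div_iff₀ (Real.exp_pos _)]
      calc Real.pi ^ 4 * Real.exp 2 ≤ 3.1416 ^ 4 * 2.7182818286 ^ 2 := by gcongr
        _ ≤ 27 ^ 2 := by norm_num
        _ ≤ _ := h2
    have h2 : Real.log (4 * n / η) ≤ 4 * r := by
      have := Nat.le_ceil (Real.log (4 * n / η) / 4)
      rw [← hr] at this
      linarith
    calc 4 * n * (Real.pi ^ 4 / (n ^ 2 * w ^ 2)) ^ (2 * r)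
        ≤ 4 * n * Real.exp (-2) ^ (2 * r) := by gcongr
      _ = 4 * n * Real.exp (-(4 * r)) := by
          rw [← Real.exp_nat_mul]; push_cast; ring_nf
      _ ≤ 4 * n * Real.exp (-Real.log (4 * n / η)) := by gcongr
      _ = η := by
          rw [Real.exp_neg, Real.exp_log (by positivity)]
          field_simp
  obtain ⟨F, hFd, hF1, hFa, hFb⟩ := exists_filter_of_pow_le ha hab hb n r (by exact_mod_cast hn')
    hdecay
  obtain ⟨P, hP, hPe⟩ := exists_phases (n * (2 * r)) (C (1 - η) * F)
    ((natDegree_C_mul_le _ _).trans hFd) (fun x hx => by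
      have h1 := hF1 (Real.arccos x)
      rw [Real.cos_arccos hx.1 hx.2] at h1
      rw [eval_mul, eval_C, abs_of_nonneg (mul_nonneg (by linarith) h1.1)]
      nlinarith)
  refine ⟨P, ?_, fun x => (1 - η) * F.eval x, fun θ => ?_, fun θ => ?_, fun θ h1 h2 => ?_,
    fun θ h1 h2 => ?_⟩
  · calc (P.m : ℝ) ≤ (n * (2 * r) : ℕ) := by exact_mod_cast hP
      _ = n * (2 * r) := by push_cast; ring
      _ ≤ 31 / w * (2 * l) := by gcongr
      _ = 62 / w * l := by ring
  · rw [hPe, eval_mul, eval_C]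
  · have := hF1 θ
    exact ⟨mul_nonneg (by linarith) this.1, by nlinarith⟩
  · have := hFa θ h1 h2
    nlinarith
  · have := hFb θ h1 h2
    have := (hF1 θ).1
    nlinarith

end Polynomials

/-! ### Stability of circuits under perturbation of the evolution oracle -/

/-- The Hilbert space norm of a joint state. -/
noncomputable def jointNorm {n : ℕ} (v : Joint n) : ℝ :=
  ‖(WithLp.toLp 2 v : PiLp 2 fun _ : Fin 2 => Sys n)‖

/-- The state after a list of operations, performed from left to right on the state `v`. -/
noncomputable def runFrom {n : ℕ} (OI : Sys n →L[ℂ] Sys n) (OH : ℝ → Sys n →L[ℂ] Sys n) (c : List Instr)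
    (v : Joint n) : Joint n :=
  c.foldl (fun v g => g.apply OI OH v) v

/-- The operation queries the evolution oracle only for times up to the cutoff `τ`. -/
def Instr.RespectsCutoff (τ : ℝ) : Instr → Prop
  | .evolve t => |t| ≤ τ
  | _ => True

section Stability

variable {n : ℕ}

theorem jointNorm_sq (v : Joint n) : jointNorm v ^ 2 = ‖v 0‖ ^ 2 + ‖v 1‖ ^ 2 := by
  rw [jointNorm, PiLp.norm_sq_eq_of_L2, Fin.sum_univ_two]

theorem jointNorm_nonneg (v : Joint n) : 0 ≤ jointNorm v := norm_nonneg _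

theorem jointNorm_add_le (v w : Joint n) : jointNorm (v + w) ≤ jointNorm v + jointNorm w := by
  simp only [jointNorm, WithLp.toLp_add]
  exact norm_add_le _ _

theorem norm_apply_zero_le_jointNorm (v : Joint n) : ‖v 0‖ ≤ jointNorm v := by
  refine le_of_sq_le_sq ?_ (jointNorm_nonneg v)
  rw [jointNorm_sq]
  exact le_add_of_nonneg_right (sq_nonneg _)

theorem jointNorm_le_of_le {v w : Joint n} (h0 : ‖v 0‖ ≤ ‖w 0‖) (h1 : ‖v 1‖ ≤ ‖w 1‖) :
    jointNorm v ≤ jointNorm w := by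
  refine le_of_sq_le_sq ?_ (jointNorm_nonneg w)
  rw [jointNorm_sq, jointNorm_sq]
  gcongr

theorem jointNorm_rotX (OI : Sys n →L[ℂ] Sys n) (OH : ℝ → Sys n →L[ℂ] Sys n) (θ : ℝ)
    (v : Joint n) : jointNorm ((Instr.rotX θ).apply OI OH v) = jointNorm v := by
  rw [← sq_eq_sq₀ (jointNorm_nonneg _) (jointNorm_nonneg _), jointNorm_sq, jointNorm_sq]
  simp only [Instr.apply, rotXMatrix, Fin.sum_univ_two, Matrix.of_apply, Matrix.cons_val_zero,
    Matrix.cons_val_one, Matrix.cons_val_fin_one]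
  rw [norm_add_sq (𝕜 := ℂ), norm_add_sq (𝕜 := ℂ)]
  simp only [norm_smul, inner_smul_left, inner_smul_right, Complex.norm_mul, Complex.norm_I,
    Complex.norm_real, mul_pow, one_mul, Real.norm_eq_abs, sq_abs, map_mul, Complex.conj_I,
    Complex.conj_ofReal]
  have h : (RCLike.re (Complex.I * (Real.sin θ : ℂ) * ((Real.cos θ : ℂ) * inner ℂ (v 0) (v 1))) : ℝ)
      = -RCLike.re ((Real.cos θ : ℂ) * (-Complex.I * (Real.sin θ : ℂ) * inner ℂ (v 0) (v 1))) := by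
    rw [← map_neg]
    congr 1
    ring
  have h2 := Real.sin_sq_add_cos_sq θ
  rw [h]
  linear_combination (‖v 0‖ ^ 2 + ‖v 1‖ ^ 2) * h2

theorem Instr.apply_sub (OI : Sys n →L[ℂ] Sys n) (OH : ℝ → Sys n →L[ℂ] Sys n) (g : Instr)
    (v w : Joint n) : g.apply OI OH (v - w) = g.apply OI OH v - g.apply OI OH w := by
  cases g <;> ext i : 1 <;> fin_cases i <;>
    simp [Instr.apply, Fin.sum_univ_two, smul_sub]

theorem Instr.jointNorm_apply_le {OI : Sys n →L[ℂ] Sys n} {OH : ℝ → Sys n →L[ℂ] Sys n} {τ : ℝ}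
    (hOI : ∀ x, ‖OI x‖ ≤ ‖x‖) (hOH : ∀ t, |t| ≤ τ → ∀ x, ‖OH t x‖ ≤ ‖x‖) {g : Instr}
    (hg : g.RespectsCutoff τ) (v : Joint n) : jointNorm (g.apply OI OH v) ≤ jointNorm v := by
  cases g with
  | initQuery => exact jointNorm_le_of_le (hOI _) (hOI _)
  | rotX θ => exact (jointNorm_rotX OI OH θ v).le
  | phaseZ θ =>
    refine jointNorm_le_of_le le_rfl (le_of_eq ?_)
    simp [Instr.apply, norm_smul, mul_comm Complex.I, Complex.norm_exp_ofReal_mul_I]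
  | evolve t => exact jointNorm_le_of_le le_rfl (hOH t hg _)
  | measure => exact jointNorm_le_of_le le_rfl (by simp [Instr.apply])

theorem jointNorm_runFrom_sub_le {OI : Sys n →L[ℂ] Sys n} {OH : ℝ → Sys n →L[ℂ] Sys n} {τ : ℝ}
    (hOI : ∀ x, ‖OI x‖ ≤ ‖x‖) (hOH : ∀ t, |t| ≤ τ → ∀ x, ‖OH t x‖ ≤ ‖x‖) {c : List Instr}
    (hc : ∀ g ∈ c, g.RespectsCutoff τ) (v w : Joint n) :
    jointNorm (runFrom OI OH c v - runFrom OI OH c w) ≤ jointNorm (v - w) := by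
  induction c generalizing v w with
  | nil => exact le_rfl
  | cons g c ih =>
    refine (ih (fun g hg => hc g (List.mem_cons_of_mem _ hg)) _ _).trans ?_
    rw [← Instr.apply_sub]
    exact Instr.jointNorm_apply_le hOI hOH (hc g List.mem_cons_self) _

/-- Errors of the evolution oracle add up. -/
theorem jointNorm_runFrom_sub_runFrom_le {OI : Sys n →L[ℂ] Sys n}
    {OH OH' : ℝ → Sys n →L[ℂ] Sys n} {τ δ : ℝ} (hδ : 0 ≤ δ)
    (hOI : ∀ x, ‖OI x‖ ≤ ‖x‖) (hOH : ∀ t, |t| ≤ τ → ∀ x, ‖OH t x‖ ≤ ‖x‖)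
    (hOH' : ∀ t, |t| ≤ τ → ∀ x, ‖OH' t x‖ ≤ ‖x‖)
    (hd : ∀ t, |t| ≤ τ → ‖OH t - OH' t‖ ≤ δ) {c : List Instr}
    (hc : ∀ g ∈ c, g.RespectsCutoff τ) (v : Joint n) :
    jointNorm (runFrom OI OH c v - runFrom OI OH' c v) ≤ c.length * δ * jointNorm v := by
  induction c generalizing v with
  | nil => simp [runFrom, jointNorm]
  | cons g c ih =>
    have hc' : ∀ g ∈ c, g.RespectsCutoff τ := fun g hg => hc g (List.mem_cons_of_mem _ hg)
    have hg := hc g List.mem_cons_self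
    have h1 := jointNorm_runFrom_sub_le hOI hOH hc' (g.apply OI OH v) (g.apply OI OH' v)
    have h2 := ih hc' (g.apply OI OH' v)
    have h3 : jointNorm (g.apply OI OH' v) ≤ jointNorm v := Instr.jointNorm_apply_le hOI hOH' hg v
    have h4 : jointNorm (g.apply OI OH v - g.apply OI OH' v) ≤ δ * jointNorm v := by
      cases g with
      | evolve t =>
        refine (le_of_sq_le_sq ?_ (by have := jointNorm_nonneg v; positivity))
        rw [jointNorm_sq, mul_pow, jointNorm_sq]
        have h5 : ‖OH t (v 1) - OH' t (v 1)‖ ≤ δ * ‖v 1‖ :=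
          (OH t - OH' t).le_of_opNorm_le (hd t hg) (v 1)
        have h6 : ‖OH t (v 1) - OH' t (v 1)‖ ^ 2 ≤ (δ * ‖v 1‖) ^ 2 :=
          pow_le_pow_left₀ (norm_nonneg _) h5 2
        have h7 : 0 ≤ δ ^ 2 * ‖v 0‖ ^ 2 := by positivity
        simp only [Instr.apply, Pi.sub_apply, Matrix.cons_val_zero, Matrix.cons_val_one,
          Matrix.cons_val_fin_one, sub_self, norm_zero]
        linarith
      | _ =>
        simp only [Instr.apply, sub_self]
        rw [show jointNorm (0 : Joint n) = 0 by simp [jointNorm]]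
        exact mul_nonneg hδ (jointNorm_nonneg v)
    have h5 : runFrom OI OH (g :: c) v - runFrom OI OH' (g :: c) v =
        (runFrom OI OH c (g.apply OI OH v) - runFrom OI OH c (g.apply OI OH' v)) +
        (runFrom OI OH c (g.apply OI OH' v) - runFrom OI OH' c (g.apply OI OH' v)) := by
      simp [runFrom]
    rw [h5]
    refine (jointNorm_add_le _ _).trans ?_
    have h6 : (c.length : ℝ) * δ * jointNorm (g.apply OI OH' v) ≤ c.length * δ * jointNorm v := by
      gcongr
    rw [List.length_cons]
    push_cast
    linarith

end Stability

/-! ### Circuits in the eigenbasis of the Hamiltonian -/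

/-- The action of an operation on the ancilla while the system is in an eigenstate with energy `lam`,
for the exact evolution. The query to the initial-state oracle does not preserve eigenstates;
it gets a dummy value. -/
noncomputable def Instr.matrix (lam : ℝ) : Instr → Matrix (Fin 2) (Fin 2) ℂ
  | .initQuery => 1
  | .rotX θ => rotXMatrix θ
  | .phaseZ θ => phaseMatrix (Complex.exp (Complex.I * (θ : ℂ)))
  | .evolve t => phaseMatrix (Complex.exp (-(Complex.I * (t : ℂ)) * (lam : ℂ)))
  | .measure => phaseMatrix 0

/-- The action of a list of operations on the ancilla while the system is in an eigenstate with energy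
`lam`. -/
noncomputable def circuitMatrix (lam : ℝ) (c : List Instr) : Matrix (Fin 2) (Fin 2) ℂ :=
  (c.map (Instr.matrix lam)).reverse.prod

/-- The ancilla amplitudes of the component of the system state along `e`. -/
noncomputable def component {n : ℕ} (e : Sys n) (v : Joint n) : Fin 2 → ℂ := fun i => inner ℂ e (v i)

theorem circuitMatrix_append (lam : ℝ) (c d : List Instr) :
    circuitMatrix lam (c ++ d) = circuitMatrix lam d * circuitMatrix lam c := by
  simp [circuitMatrix]

theorem circuitMatrix_cons (lam : ℝ) (g : Instr) (c : List Instr) :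
    circuitMatrix lam (g :: c) = circuitMatrix lam c * g.matrix lam := by
  simp [circuitMatrix]

theorem circuitMatrix_nil (lam : ℝ) : circuitMatrix lam [] = 1 := by simp [circuitMatrix]

theorem phaseMatrix_mul (z w : ℂ) : phaseMatrix z * phaseMatrix w = phaseMatrix (z * w) := by
  ext i j
  fin_cases i <;> fin_cases j <;> simp [phaseMatrix, Matrix.mul_apply]

theorem phaseMatrix_one : phaseMatrix 1 = 1 := by
  ext i j
  fin_cases i <;> fin_cases j <;> simp [phaseMatrix]

theorem phaseMatrix_pow (z : ℂ) (r : ℕ) : phaseMatrix z ^ r = phaseMatrix (z ^ r) := by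
  induction r with
  | zero => simp [phaseMatrix_one]
  | succ r ih => rw [pow_succ, ih, phaseMatrix_mul, pow_succ]

theorem circuitMatrix_controlledEvolution {τ : ℝ} (hτ : 0 < τ) (σ t lam : ℝ) :
    circuitMatrix lam (controlledEvolution τ σ t) =
      phaseMatrix (Complex.exp (-((t * (lam - σ) : ℝ) * Complex.I))) := by
  rw [controlledEvolution, circuitMatrix_append]
  have h1 : circuitMatrix lam (List.replicate ⌈|t| / τ⌉₊ (Instr.evolve (t / ⌈|t| / τ⌉₊))) =
      phaseMatrix (Complex.exp (-(Complex.I * (t : ℂ)) * (lam : ℂ))) := by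
    rw [circuitMatrix, List.map_replicate, List.reverse_replicate, List.prod_replicate,
      Instr.matrix, phaseMatrix_pow, ← Complex.exp_nat_mul]
    by_cases h0 : t = 0
    · simp [h0]
    · have h2 : ((⌈|t| / τ⌉₊ : ℕ) : ℂ) ≠ 0 := by
        rw [Nat.cast_ne_zero]
        exact (Nat.ceil_pos.2 (div_pos (abs_pos.2 h0) hτ)).ne'
      congr 2
      push_cast
      field_simp
  rw [h1, circuitMatrix_cons, circuitMatrix_nil, one_mul, Instr.matrix, phaseMatrix_mul,
    ← Complex.exp_add]
  congr 2
  push_cast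
  ring

theorem circuitMatrix_qetu {τ : ℝ} (hτ : 0 < τ) (σ t lam : ℝ) (P : Phases) :
    circuitMatrix lam (qetu τ σ t P) = alternatingProduct
      (Complex.exp (-((t * (lam - σ) : ℝ) * Complex.I))) P.φ (2 * P.m) := by
  rw [qetu]
  generalize P.m = m
  induction m with
  | zero => simp [circuitMatrix_cons, circuitMatrix_nil, alternatingProduct, Instr.matrix]
  | succ m ih =>
    have h1 : Complex.exp (-((-t * (lam - σ) : ℝ) * Complex.I)) =
        (Complex.exp (-((t * (lam - σ) : ℝ) * Complex.I)))⁻¹ := by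
      rw [← Complex.exp_neg]
      congr 1
      push_cast
      ring
    rw [List.range_succ, List.flatMap_append, ← List.cons_append, circuitMatrix_append, ih]
    simp only [List.flatMap_cons, List.flatMap_nil, List.append_nil, circuitMatrix_append,
      circuitMatrix_cons, circuitMatrix_nil, one_mul, circuitMatrix_controlledEvolution hτ, h1,
      Instr.matrix]
    rw [show 2 * (m + 1) = 2 * m + 1 + 1 by ring, alternatingProduct, alternatingProduct]
    simp [Matrix.mul_assoc, show 2 * m + 2 = 2 * m + 1 + 1 by ring]

theorem circuitMatrix_measured_mulVec (lam : ℝ) (c : List Instr) (a : ℂ) :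
    (circuitMatrix lam (c ++ [.measure])).mulVec ![a, 0] = ![circuitMatrix lam c 0 0 * a, 0] := by
  rw [circuitMatrix_append, circuitMatrix_cons, circuitMatrix_nil, one_mul, Instr.matrix]
  ext i
  fin_cases i <;> simp [phaseMatrix, Matrix.mulVec, dotProduct, Matrix.mul_apply,
    Fin.sum_univ_two]

section Eigenbasis

variable {n : ℕ} {H : Sys n →L[ℂ] Sys n} {lam : Fin (2 ^ n) → ℝ}
  {psi : OrthonormalBasis (Fin (2 ^ n)) ℂ (Sys n)}

theorem exp_apply_of_apply_eq_smul {A : Sys n →L[ℂ] Sys n} {x : Sys n} {a : ℂ} (h : A x = a • x) :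
    NormedSpace.exp A x = Complex.exp a • x := by
  have hpow (k : ℕ) : (A ^ k) x = a ^ k • x := by
    induction k with
    | zero => simp
    | succ k ih => rw [pow_succ', mul_apply_eq_comp, ih, map_smul, h, smul_smul, pow_succ]
  have h1 := (NormedSpace.exp_series_hasSum_exp' (𝕂 := ℂ) A).mapL
    (ContinuousLinearMap.apply ℂ (Sys n) x)
  have h2 := ((NormedSpace.exp_series_hasSum_exp' (𝕂 := ℂ) a).smul_const x)
  rw [← Complex.exp_eq_exp_ℂ] at h2
  have h3 : (fun k : ℕ => ContinuousLinearMap.apply ℂ (Sys n) x (((k.factorial : ℂ)⁻¹) • A ^ k)) =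
      fun k : ℕ => (((k.factorial : ℂ)⁻¹) • a ^ k) • x := by
    funext k
    simp [hpow, smul_smul]
  rw [h3] at h1
  exact h1.unique h2

theorem evolution_apply_eigenvector (he : IsEigensystem H lam psi) (t : ℝ) (k : Fin (2 ^ n)) :
    evolution H t (psi k) = Complex.exp (-(Complex.I * (t : ℂ)) * (lam k : ℂ)) • psi k := by
  apply exp_apply_of_apply_eq_smul
  rw [smul_apply, he.2 k, smul_smul]

theorem inner_evolution (he : IsEigensystem H lam psi) (t : ℝ) (k : Fin (2 ^ n)) (x : Sys n) :
    inner ℂ (psi k) (evolution H t x) =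
      Complex.exp (-(Complex.I * (t : ℂ)) * (lam k : ℂ)) * inner ℂ (psi k) x := by
  conv_lhs => rw [← psi.sum_repr' x]
  rw [map_sum, inner_sum, Finset.sum_eq_single k]
  · rw [map_smul, evolution_apply_eigenvector he, inner_smul_right, inner_smul_right,
      inner_self_eq_norm_sq_to_K, psi.norm_eq_one]
    simp [mul_comm]
  · intro j _ hj
    rw [map_smul, evolution_apply_eigenvector he, inner_smul_right, inner_smul_right,
      psi.inner_eq_zero hj.symm, mul_zero, mul_zero]
  · simp

theorem norm_evolution_apply (he : IsEigensystem H lam psi) (t : ℝ) (x : Sys n) :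
    ‖evolution H t x‖ = ‖x‖ := by
  rw [← sq_eq_sq₀ (norm_nonneg _) (norm_nonneg _), ← psi.sum_sq_norm_inner_right,
    ← psi.sum_sq_norm_inner_right x]
  refine Finset.sum_congr rfl fun k _ => ?_
  rw [inner_evolution he, norm_mul, Complex.norm_exp]
  simp

theorem component_runFrom (he : IsEigensystem H lam psi) (OI : Sys n →L[ℂ] Sys n)
    (k : Fin (2 ^ n)) {c : List Instr} (hc : Instr.initQuery ∉ c) (v : Joint n) :
    component (psi k) (runFrom OI (evolution H) c v) =
      (circuitMatrix (lam k) c).mulVec (component (psi k) v) := by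
  induction c generalizing v with
  | nil => simp [runFrom, circuitMatrix_nil]
  | cons g c ih =>
    rw [circuitMatrix_cons, ← Matrix.mulVec_mulVec]
    have h1 : runFrom OI (evolution H) (g :: c) v =
      runFrom OI (evolution H) c (g.apply OI (evolution H) v) := rfl
    rw [h1, ih (fun h => hc (List.mem_cons_of_mem _ h))]
    congr 1
    cases g with
    | initQuery => exact absurd List.mem_cons_self hc
    | rotX θ =>
      ext i
      simp [component, Instr.apply, Instr.matrix, Matrix.mulVec, dotProduct, Fin.sum_univ_two]
    | phaseZ θ =>
      ext i
      fin_cases i <;> simp [component, Instr.apply, Instr.matrix, Matrix.mulVec, dotProduct, Fin.sum_univ_two, phaseMatrix]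
    | evolve t =>
      ext i
      fin_cases i <;> simp [component, Instr.apply, Instr.matrix, Matrix.mulVec, dotProduct,
        inner_evolution he, Fin.sum_univ_two, phaseMatrix]
    | measure =>
      ext i
      fin_cases i <;> simp [component, Instr.apply, Instr.matrix, Matrix.mulVec, dotProduct,
        Fin.sum_univ_two, phaseMatrix]

end Eigenbasis

/-! ### One attempt of the multi-level method -/

theorem respectsCutoff_and_ne_initQuery_of_mem_controlledEvolution {τ : ℝ} (hτ : 0 < τ) {σ t : ℝ} {g : Instr}
    (hg : g ∈ controlledEvolution τ σ t) : g.RespectsCutoff τ ∧ g ≠ .initQuery := by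
  simp only [controlledEvolution, List.mem_append, List.mem_replicate, List.mem_singleton] at hg
  rcases hg with ⟨h0, rfl⟩ | rfl
  · refine ⟨?_, by simp⟩
    have h1 : (0 : ℝ) < ⌈|t| / τ⌉₊ := Nat.cast_pos.2 (Nat.pos_of_ne_zero h0)
    rw [Instr.RespectsCutoff, abs_div, Nat.abs_cast, div_le_iff₀ h1, mul_comm, ← div_le_iff₀ hτ]
    exact Nat.le_ceil _
  · exact ⟨trivial, by simp⟩

theorem respectsCutoff_and_ne_initQuery_of_mem_qetu {τ : ℝ} (hτ : 0 < τ) {σ t : ℝ} {P : Phases} {g : Instr}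
    (hg : g ∈ qetu τ σ t P) : g.RespectsCutoff τ ∧ g ≠ .initQuery := by
  simp only [qetu, List.mem_cons, List.mem_flatMap, List.mem_append, List.not_mem_nil,
    or_false] at hg
  rcases hg with rfl | ⟨j, -, h | rfl | h | rfl⟩
  · exact ⟨trivial, by simp⟩
  · exact respectsCutoff_and_ne_initQuery_of_mem_controlledEvolution hτ h
  · exact ⟨trivial, by simp⟩
  · exact respectsCutoff_and_ne_initQuery_of_mem_controlledEvolution hτ h
  · exact ⟨trivial, by simp⟩

/-- The part of an attempt after the query to the initial-state oracle. -/
noncomputable def MultiLevel.filters (A : MultiLevel) (Λ τ σ : ℝ) : List Instr :=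
  ((List.range A.levels).flatMap fun l =>
      qetu τ σ (2 ^ (l + 1) / Λ) A.levelPhases ++ [.measure]) ++
    (qetu τ σ A.cleanTime A.cleanPhases ++ [.measure])

theorem MultiLevel.attempt_eq (A : MultiLevel) (Λ τ σ : ℝ) :
    A.attempt Λ τ σ = .initQuery :: A.filters Λ τ σ := rfl

theorem respectsCutoff_and_ne_initQuery_of_mem_filters {A : MultiLevel} {Λ τ σ : ℝ} (hτ : 0 < τ) {g : Instr}
    (hg : g ∈ A.filters Λ τ σ) : g.RespectsCutoff τ ∧ g ≠ .initQuery := by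
  simp only [MultiLevel.filters, List.mem_flatMap, List.mem_append, List.mem_singleton] at hg
  rcases hg with ⟨j, -, h | rfl⟩ | h | rfl
  · exact respectsCutoff_and_ne_initQuery_of_mem_qetu hτ h
  · exact ⟨trivial, by simp⟩
  · exact respectsCutoff_and_ne_initQuery_of_mem_qetu hτ h
  · exact ⟨trivial, by simp⟩

/-- The factor by which an attempt with exact evolution multiplies the amplitude of an eigenstate with
energy `lam`. -/
noncomputable def MultiLevel.amplitude (A : MultiLevel) (Λ τ σ lam : ℝ) : ℂ :=
  circuitMatrix lam (qetu τ σ A.cleanTime A.cleanPhases) 0 0 *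
    ∏ l ∈ Finset.range A.levels,
      circuitMatrix lam (qetu τ σ (2 ^ (l + 1) / Λ) A.levelPhases) 0 0

theorem circuitMatrix_filters_mulVec (A : MultiLevel) (Λ τ σ lam : ℝ) (a : ℂ) :
    (circuitMatrix lam (A.filters Λ τ σ)).mulVec ![a, 0] = ![A.amplitude Λ τ σ lam * a, 0] := by
  have h (L : ℕ) : (circuitMatrix lam ((List.range L).flatMap fun l =>
      qetu τ σ (2 ^ (l + 1) / Λ) A.levelPhases ++ [.measure])).mulVec ![a, 0] =
      ![(∏ l ∈ Finset.range L,
        circuitMatrix lam (qetu τ σ (2 ^ (l + 1) / Λ) A.levelPhases) 0 0) * a, 0] := by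
    induction L with
    | zero => simp [circuitMatrix_nil]
    | succ L ih =>
      rw [List.range_succ, List.flatMap_append, circuitMatrix_append, ← Matrix.mulVec_mulVec, ih,
        List.flatMap_singleton, circuitMatrix_measured_mulVec, Finset.prod_range_succ]
      congr 1
      ring
  rw [MultiLevel.filters, circuitMatrix_append, ← Matrix.mulVec_mulVec, h,
    circuitMatrix_measured_mulVec, MultiLevel.amplitude, mul_assoc]

section Attempt

variable {n : ℕ} {H : Sys n →L[ℂ] Sys n} {lam : Fin (2 ^ n) → ℝ}
  {psi : OrthonormalBasis (Fin (2 ^ n)) ℂ (Sys n)} {OI : Sys n →L[ℂ] Sys n}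
  {OH : ℝ → Sys n →L[ℂ] Sys n}

theorem inner_output_evolution (he : IsEigensystem H lam psi) {A : MultiLevel} {Λ τ σ : ℝ}
    (hτ : 0 < τ) (k : Fin (2 ^ n)) :
    inner ℂ (psi k) (A.output Λ τ σ OI (evolution H)) =
      A.amplitude Λ τ σ (lam k) * inner ℂ (psi k) (OI (zeroSys n)) := by
  have h1 : A.output Λ τ σ OI (evolution H) =
    runFrom OI (evolution H) (A.filters Λ τ σ) (fun i => OI (zeroJoint n i)) 0 := rfl
  have h2 := component_runFrom he OI k
    (fun h => (respectsCutoff_and_ne_initQuery_of_mem_filters (A := A) (Λ := Λ) (σ := σ) hτ h).2 rfl)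
    (fun i => OI (zeroJoint n i))
  have h3 : component (psi k) (fun i => OI (zeroJoint n i)) =
      ![inner ℂ (psi k) (OI (zeroSys n)), 0] := by
    ext i
    fin_cases i <;> simp [component, zeroJoint]
  rw [h3, circuitMatrix_filters_mulVec] at h2
  rw [h1]
  exact congrFun h2 0

theorem norm_apply_of_mem_unitary {U : Sys n →L[ℂ] Sys n} (hU : U ∈ unitary (Sys n →L[ℂ] Sys n))
    (x : Sys n) : ‖U x‖ = ‖x‖ :=
  ContinuousLinearMap.norm_map_of_mem_unitary hU x

theorem jointNorm_zeroJoint : jointNorm (zeroJoint n) = 1 := by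
  rw [← sq_eq_sq₀ (jointNorm_nonneg _) zero_le_one, jointNorm_sq]
  simp [zeroJoint, zeroSys]

theorem MultiLevel.output_eq (A : MultiLevel) (Λ τ σ : ℝ) (OI : Sys n →L[ℂ] Sys n)
    (OH : ℝ → Sys n →L[ℂ] Sys n) :
    A.output Λ τ σ OI OH = runFrom OI OH (A.attempt Λ τ σ) (zeroJoint n) 0 := rfl

theorem norm_output_le_one {A : MultiLevel} {Λ τ σ δ : ℝ} (hτ : 0 < τ)
    (hOI : OI ∈ unitary (Sys n →L[ℂ] Sys n)) (hOH : IsCutoffEvolution τ δ H OH) :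
    ‖A.output Λ τ σ OI OH‖ ≤ 1 := by
  have h1 := jointNorm_runFrom_sub_le (fun x => (norm_apply_of_mem_unitary hOI x).le)
    (fun t ht x => (norm_apply_of_mem_unitary (hOH t ht).1 x).le)
    (c := A.attempt Λ τ σ) (by
      rw [MultiLevel.attempt_eq]
      intro g hg
      rcases List.mem_cons.1 hg with rfl | hg
      · trivial
      · exact (respectsCutoff_and_ne_initQuery_of_mem_filters hτ hg).1) (zeroJoint n) 0
  have h2 : runFrom OI OH (A.attempt Λ τ σ) 0 = 0 := by
    generalize A.attempt Λ τ σ = c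
    induction c with
    | nil => rfl
    | cons g c ih =>
      have h3 := Instr.apply_sub OI OH g 0 0
      rw [sub_self, sub_self] at h3
      change runFrom OI OH c (g.apply OI OH 0) = 0
      rw [h3, ih]
  rw [h2, sub_zero, sub_zero, jointNorm_zeroJoint] at h1
  rw [MultiLevel.output_eq]
  exact (norm_apply_zero_le_jointNorm _).trans h1

theorem norm_output_sub_le (he : IsEigensystem H lam psi) {A : MultiLevel} {Λ τ σ δ : ℝ}
    (hτ : 0 < τ) (hδ : 0 ≤ δ)
    (hOI : OI ∈ unitary (Sys n →L[ℂ] Sys n)) (hOH : IsCutoffEvolution τ δ H OH) :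
    ‖A.output Λ τ σ OI OH - A.output Λ τ σ OI (evolution H)‖ ≤
      (A.attempt Λ τ σ).length * δ := by
  have h1 := jointNorm_runFrom_sub_runFrom_le hδ
    (fun x => (norm_apply_of_mem_unitary hOI x).le)
    (fun t ht x => (norm_apply_of_mem_unitary (hOH t ht).1 x).le)
    (fun t _ x => (norm_evolution_apply he t x).le) (fun t ht => (hOH t ht).2)
    (c := A.attempt Λ τ σ) (by
      rw [MultiLevel.attempt_eq]
      intro g hg
      rcases List.mem_cons.1 hg with rfl | hg
      · trivial
      · exact (respectsCutoff_and_ne_initQuery_of_mem_filters hτ hg).1) (zeroJoint n)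
  rw [jointNorm_zeroJoint, mul_one] at h1
  rw [MultiLevel.output_eq, MultiLevel.output_eq, ← Pi.sub_apply]
  exact (norm_apply_zero_le_jointNorm _).trans h1

/-- If an attempt with exact evolution roughly keeps the ground state and suppresses the excited
states, then an attempt with sufficiently precise evolution outputs the ground state with a
probability of order `γ²`. -/
theorem output_bounds (he : IsEigensystem H lam psi) {A : MultiLevel} {Λ τ σ δ γ ε : ℝ}
    (hτ : 0 < τ) (hδ : 0 ≤ δ) (hγ : 0 < γ) (hε : 0 < ε) (hε1 : ε < 1)
    (hOI : OI ∈ unitary (Sys n →L[ℂ] Sys n)) (hOH : IsCutoffEvolution τ δ H OH)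
    (hinit : ‖inner ℂ (OI (zeroSys n)) (psi 0)‖ = γ)
    (hground : 7 / 8 ≤ ‖A.amplitude Λ τ σ (lam 0)‖)
    (hexc : ∀ k, k ≠ 0 → ‖A.amplitude Λ τ σ (lam k)‖ ≤ ε * γ / 16)
    (hlen : (A.attempt Λ τ σ).length * δ ≤ ε * γ / 16) :
    γ ^ 2 / 4 ≤ ‖A.output Λ τ σ OI OH‖ ^ 2 ∧
      1 - ε ≤ fidelity (psi 0) (A.output Λ τ σ OI OH) := by
  set v := A.output Λ τ σ OI OH with hv
  set v' := A.output Λ τ σ OI (evolution H) with hv'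
  have hd : ‖v - v'‖ ≤ ε * γ / 16 := (norm_output_sub_le he hτ hδ hOI hOH).trans hlen
  have hεγ : ε * γ ≤ γ := by nlinarith
  have hp0 : γ / 2 ≤ ‖inner ℂ (psi 0) v‖ := by
    have h1 : inner ℂ (psi 0) v' = inner ℂ (psi 0) v - inner ℂ (psi 0) (v - v') := by
      rw [inner_sub_right]; ring
    have h2 : ‖inner ℂ (psi 0) (v - v')‖ ≤ ε * γ / 16 :=
      (norm_inner_le_norm _ _).trans (by rw [psi.norm_eq_one, one_mul]; exact hd)
    have h3 : 7 / 8 * γ ≤ ‖inner ℂ (psi 0) v'‖ := by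
      rw [hv', inner_output_evolution he hτ, norm_mul, norm_inner_symm, hinit]
      gcongr
    have h4 : ‖inner ℂ (psi 0) v'‖ ≤ ‖inner ℂ (psi 0) v‖ + ‖inner ℂ (psi 0) (v - v')‖ := by
      rw [h1]; exact norm_sub_le _ _
    linarith
  set p := ‖inner ℂ (psi 0) v‖ ^ 2 with hp
  have hpγ : γ ^ 2 / 4 ≤ p := by
    have := pow_le_pow_left₀ (by positivity) hp0 2
    linarith
  have hsum := psi.sum_sq_norm_inner_right v
  rw [← Finset.add_sum_erase _ _ (Finset.mem_univ 0)] at hsum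
  have hrest : ∑ k ∈ Finset.univ.erase 0, ‖inner ℂ (psi k) v‖ ^ 2 ≤ 4 * (ε * γ / 16) ^ 2 := by
    have hφ : ∑ k, ‖inner ℂ (psi k) (OI (zeroSys n))‖ ^ 2 = 1 := by
      rw [psi.sum_sq_norm_inner_right, norm_apply_of_mem_unitary hOI]
      simp [zeroSys]
    have h1 : ∀ k ∈ Finset.univ.erase (0 : Fin (2 ^ n)), ‖inner ℂ (psi k) v‖ ^ 2 ≤
        2 * ((ε * γ / 16) ^ 2 * ‖inner ℂ (psi k) (OI (zeroSys n))‖ ^ 2) +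
          2 * ‖inner ℂ (psi k) (v - v')‖ ^ 2 := by
      intro k hk
      have h2 : inner ℂ (psi k) v = inner ℂ (psi k) v' + inner ℂ (psi k) (v - v') := by
        rw [inner_sub_right]; ring
      have h3 : ‖inner ℂ (psi k) v'‖ ≤ ε * γ / 16 * ‖inner ℂ (psi k) (OI (zeroSys n))‖ := by
        rw [hv', inner_output_evolution he hτ, norm_mul]
        gcongr
        exact hexc k (Finset.ne_of_mem_erase hk)
      have h4 := pow_le_pow_left₀ (norm_nonneg _) h3 2
      have h5 : ‖inner ℂ (psi k) v‖ ^ 2 ≤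
          (‖inner ℂ (psi k) v'‖ + ‖inner ℂ (psi k) (v - v')‖) ^ 2 := by
        rw [h2]
        exact pow_le_pow_left₀ (norm_nonneg _) (norm_add_le _ _) 2
      have h6 := sq_nonneg (‖inner ℂ (psi k) v'‖ - ‖inner ℂ (psi k) (v - v')‖)
      rw [← mul_pow]
      linarith
    calc _ ≤ ∑ k ∈ Finset.univ.erase (0 : Fin (2 ^ n)),
          (2 * ((ε * γ / 16) ^ 2 * ‖inner ℂ (psi k) (OI (zeroSys n))‖ ^ 2) +
            2 * ‖inner ℂ (psi k) (v - v')‖ ^ 2) := Finset.sum_le_sum h1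
      _ ≤ ∑ k, (2 * ((ε * γ / 16) ^ 2 * ‖inner ℂ (psi k) (OI (zeroSys n))‖ ^ 2) +
            2 * ‖inner ℂ (psi k) (v - v')‖ ^ 2) :=
          Finset.sum_le_sum_of_subset_of_nonneg (Finset.erase_subset _ _)
            fun _ _ _ => by positivity
      _ = 2 * (ε * γ / 16) ^ 2 + 2 * ‖v - v'‖ ^ 2 := by
          rw [Finset.sum_add_distrib, ← Finset.mul_sum, ← Finset.mul_sum, ← Finset.mul_sum, hφ,
            psi.sum_sq_norm_inner_right, mul_one]
      _ ≤ _ := by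
          have := pow_le_pow_left₀ (norm_nonneg _) hd 2
          linarith
  have hrest0 : 0 ≤ ∑ k ∈ Finset.univ.erase 0, ‖inner ℂ (psi k) v‖ ^ 2 :=
    Finset.sum_nonneg fun _ _ => by positivity
  have hγ2 : 0 < γ ^ 2 := by positivity
  refine ⟨by linarith, ?_⟩
  have hvpos : 0 < ‖v‖ ^ 2 := by linarith
  have hfid : fidelity (psi 0) v = p / ‖v‖ ^ 2 := by
    rw [fidelity, inner_smul_right, norm_mul, norm_inv, Complex.norm_real, norm_norm, mul_pow,
      inv_pow, hp]
    field_simp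
  rw [hfid, le_div_iff₀ hvpos]
  have h1 : 4 * (ε * γ / 16) ^ 2 ≤ ε * (γ ^ 2 / 4) := by
    have : ε ^ 2 ≤ ε := by nlinarith
    nlinarith
  have h2 : ε * (γ ^ 2 / 4) ≤ ε * ‖v‖ ^ 2 := by
    gcongr
    linarith
  linarith

end Attempt

theorem retryProb_eq (p : ℝ) (R : ℕ) : retryProb p R = 1 - (1 - p) ^ R := by
  induction R with
  | zero => simp [retryProb]
  | succ R ih => rw [retryProb, ih, pow_succ]; ring

theorem two_thirds_le_retryProb {p γ : ℝ} (hγ : 0 < γ) (hp : γ ^ 2 / 4 ≤ p) (hp1 : p ≤ 1) :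
    2 / 3 ≤ retryProb p ⌈5 / γ ^ 2⌉₊ := by
  rw [retryProb_eq]
  have h1 : 5 / γ ^ 2 ≤ (⌈5 / γ ^ 2⌉₊ : ℝ) := Nat.le_ceil _
  have hp0 : 0 ≤ p := le_trans (by positivity) hp
  have h2 : 5 / 4 ≤ p * ⌈5 / γ ^ 2⌉₊ := by
    calc (5 / 4 : ℝ) = γ ^ 2 / 4 * (5 / γ ^ 2) := by field_simp
      _ ≤ _ := by gcongr
  have h3 : (1 - p) ^ ⌈5 / γ ^ 2⌉₊ ≤ Real.exp (-(5 / 4)) := by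
    calc (1 - p) ^ ⌈5 / γ ^ 2⌉₊ ≤ Real.exp (-p) ^ ⌈5 / γ ^ 2⌉₊ :=
          pow_le_pow_left₀ (by linarith) (Real.one_sub_le_exp_neg p) _
      _ = Real.exp (-(p * ⌈5 / γ ^ 2⌉₊)) := by rw [← Real.exp_nat_mul]; ring_nf
      _ ≤ _ := by gcongr
  have h4 : Real.exp (-(5 / 4)) ≤ 1 / 3 := by
    rw [Real.exp_neg, inv_le_comm₀ (Real.exp_pos _) (by norm_num), one_div, inv_inv]
    have := Real.sum_le_exp_of_nonneg (x := 5 / 4) (by norm_num) 4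
    norm_num [Finset.sum_range_succ, Nat.factorial] at this
    linarith
  linarith

/-! ### Amplitudes of the ground state and of the excited states -/

theorem MultiLevel.exists_amplitude_eq {A : MultiLevel} {Λ τ σ a b a' b' η : ℝ} (hτ : 0 < τ)
    (hl : A.levelPhases.IsFilter a b η) (hc : A.cleanPhases.IsFilter a' b' η) :
    ∃ F G : ℝ → ℝ,
      (∀ lam, ‖A.amplitude Λ τ σ lam‖ = G (Real.cos (A.cleanTime * (lam - σ))) *
        ∏ l ∈ Finset.range A.levels, F (Real.cos (2 ^ (l + 1) / Λ * (lam - σ)))) ∧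
      ((∀ θ, 0 ≤ F (Real.cos θ) ∧ F (Real.cos θ) ≤ 1) ∧
        (∀ θ, 0 ≤ θ → θ ≤ a → 1 - 2 * η ≤ F (Real.cos θ)) ∧
        (∀ θ, b ≤ θ → θ ≤ Real.pi → F (Real.cos θ) ≤ η)) ∧
      ((∀ θ, 0 ≤ G (Real.cos θ) ∧ G (Real.cos θ) ≤ 1) ∧
        (∀ θ, 0 ≤ θ → θ ≤ a' → 1 - 2 * η ≤ G (Real.cos θ)) ∧
        (∀ θ, b' ≤ θ → θ ≤ Real.pi → G (Real.cos θ) ≤ η)) := by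
  obtain ⟨F, hF, hF'⟩ := hl
  obtain ⟨G, hG, hG'⟩ := hc
  refine ⟨F, G, fun lam => ?_, hF', hG'⟩
  rw [MultiLevel.amplitude]
  simp_rw [circuitMatrix_qetu hτ]
  rw [hG, norm_mul, norm_prod, Complex.norm_real, Real.norm_of_nonneg (hG'.1 _).1]
  congr 1
  refine Finset.prod_congr rfl fun l _ => ?_
  rw [hF, Complex.norm_real, Real.norm_of_nonneg (hF'.1 _).1]

theorem MultiLevel.le_norm_amplitude {A : MultiLevel} {Λ τ σ b a' b' η lam : ℝ} (hτ : 0 < τ)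
    (hl : A.levelPhases.IsFilter (Real.pi / 4) b η) (hc : A.cleanPhases.IsFilter a' b' η)
    (hΛ : 0 < Λ) (hL : 2 ^ A.levels ≤ Λ) (ht : 0 ≤ A.cleanTime) (hσ : σ ≤ lam)
    (hlam : lam ≤ σ + Real.pi / 4) (hclean : A.cleanTime * (lam - σ) ≤ a')
    (hη0 : 0 ≤ η) (hη : 2 * η * (A.levels + 1) ≤ 1 / 8) :
    7 / 8 ≤ ‖A.amplitude Λ τ σ lam‖ := by
  obtain ⟨F, G, hA, hF, hG⟩ := MultiLevel.exists_amplitude_eq (Λ := Λ) (σ := σ) hτ hl hc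
  have hη1 : 0 ≤ 1 - 2 * η := by
    have : 0 ≤ 2 * η * A.levels := by positivity
    nlinarith
  have h1 : (1 - 2 * η) ^ A.levels ≤
      ∏ l ∈ Finset.range A.levels, F (Real.cos (2 ^ (l + 1) / Λ * (lam - σ))) := by
    rw [← Finset.card_range A.levels, ← Finset.prod_const, Finset.card_range]
    refine Finset.prod_le_prod (fun _ _ => hη1) fun l hl => ?_
    have h2 : (2 : ℝ) ^ (l + 1) / Λ ≤ 1 := by
      rw [div_le_one hΛ]
      exact (pow_le_pow_right₀ one_le_two (Finset.mem_range.1 hl)).trans hL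
    have h3 : 0 ≤ lam - σ := by linarith
    refine hF.2.1 _ (by positivity) ?_
    calc 2 ^ (l + 1) / Λ * (lam - σ) ≤ 1 * (lam - σ) := by gcongr
      _ ≤ _ := by linarith
  have h2 := hG.2.1 _ (mul_nonneg ht (sub_nonneg.2 hσ)) hclean
  rw [hA]
  have h3 := one_add_mul_le_pow (a := -(2 * η)) (by linarith) (A.levels + 1)
  calc (7 / 8 : ℝ) ≤ 1 + ((A.levels + 1 : ℕ) : ℝ) * -(2 * η) := by push_cast; linarith
    _ ≤ (1 + -(2 * η)) ^ (A.levels + 1) := h3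
    _ = (1 - 2 * η) * (1 - 2 * η) ^ A.levels := by ring
    _ ≤ _ := mul_le_mul h2 h1 (pow_nonneg hη1 _) (hη1.trans h2)

/-- An excited state is stopped by one of the filters: an energy that passes all the levels satisfies
`2 ^ ℓ / Λ * (lam - σ) < π / 2` for all of them, since the angle at most
doubles from one level to the next and never enters `[π / 2, π]`. Its angle in the
clean-up filter is then less than `π`. -/
theorem MultiLevel.norm_amplitude_le {A : MultiLevel} {Λ τ σ a a' b' η lam : ℝ} (hτ : 0 < τ)
    (hl : A.levelPhases.IsFilter a (Real.pi / 2) η) (hc : A.cleanPhases.IsFilter a' b' η)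
    (hΛ : 0 < Λ) (hL : A.cleanTime ≤ 2 * (2 ^ A.levels / Λ)) (hσ : σ ≤ lam)
    (hlam : lam - σ ≤ Λ) (hclean : b' ≤ A.cleanTime * (lam - σ)) :
    ‖A.amplitude Λ τ σ lam‖ ≤ η := by
  obtain ⟨F, G, hA, hF, hG⟩ := MultiLevel.exists_amplitude_eq (Λ := Λ) (σ := σ) hτ hl hc
  rw [hA]
  have hu : 0 ≤ lam - σ := sub_nonneg.2 hσ
  by_cases hex : ∃ l ∈ Finset.range A.levels, Real.cos (2 ^ (l + 1) / Λ * (lam - σ)) ≤ 0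
  · obtain ⟨l, hl, hcos⟩ := hex
    have h1 : F (Real.cos (2 ^ (l + 1) / Λ * (lam - σ))) ≤ η := by
      rw [← Real.cos_arccos (Real.neg_one_le_cos _) (Real.cos_le_one
        (2 ^ (l + 1) / Λ * (lam - σ)))]
      exact hF.2.2 _ 
        (by rw [Real.arccos]; linarith [Real.arcsin_nonpos.2 hcos]) (Real.arccos_le_pi _)
    rw [← Finset.mul_prod_erase _ _ hl]
    have h2 : ∏ l ∈ (Finset.range A.levels).erase l,
        F (Real.cos (2 ^ (l + 1) / Λ * (lam - σ))) ≤ 1 :=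
      Finset.prod_le_one (fun _ _ => (hF.1 _).1) fun _ _ => (hF.1 _).2
    have h3 := (hF.1 (2 ^ (l + 1) / Λ * (lam - σ))).1
    have h4 := (hG.1 (A.cleanTime * (lam - σ))).2
    have h5 : 0 ≤ ∏ l ∈ (Finset.range A.levels).erase l,
        F (Real.cos (2 ^ (l + 1) / Λ * (lam - σ))) := Finset.prod_nonneg fun _ _ => (hF.1 _).1
    exact (mul_le_of_le_one_left (mul_nonneg h3 h5) h4).trans
      ((mul_le_of_le_one_right h3 h2).trans h1)
  · push Not at hex
    have h1 : ∀ l ≤ A.levels, 2 ^ l / Λ * (lam - σ) < Real.pi / 2 := by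
      intro l hl
      induction l with
      | zero =>
        have : (lam - σ) / Λ ≤ 1 := (div_le_one hΛ).2 hlam
        rw [pow_zero, one_div_mul_eq_div]
        linarith [Real.pi_gt_three]
      | succ l ih =>
        by_contra h
        have h2 := ih (Nat.le_of_succ_le hl)
        have h3 : 2 ^ (l + 1) / Λ * (lam - σ) = 2 * (2 ^ l / Λ * (lam - σ)) := by ring
        have h4 := hex l (Finset.mem_range.2 hl)
        exact absurd h4 (not_lt.2 (Real.cos_nonpos_of_pi_div_two_le_of_le (not_lt.1 h)
          (by rw [h3]; linarith [Real.pi_pos])))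
    have h2 : A.cleanTime * (lam - σ) ≤ Real.pi := by
      calc A.cleanTime * (lam - σ) ≤ 2 * (2 ^ A.levels / Λ) * (lam - σ) := by gcongr
        _ = 2 * (2 ^ A.levels / Λ * (lam - σ)) := by ring
        _ ≤ _ := by linarith [h1 _ le_rfl]
    have h3 : ∏ l ∈ Finset.range A.levels, F (Real.cos (2 ^ (l + 1) / Λ * (lam - σ))) ≤ 1 :=
      Finset.prod_le_one (fun _ _ => (hF.1 _).1) fun _ _ => (hF.1 _).2
    have h4 := (hG.1 (A.cleanTime * (lam - σ))).1
    exact (mul_le_of_le_one_right h4 h3).trans (hG.2.2 _ hclean h2)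

/-! ### Gate counts -/

theorem gates_controlledEvolution (τ σ t : ℝ) (κ : ℕ) :
    ((controlledEvolution τ σ t).map (Instr.gates κ)).sum = ⌈|t| / τ⌉₊ * κ + 1 := by
  simp [controlledEvolution, Instr.gates]

theorem gates_qetu (τ σ t : ℝ) (κ : ℕ) (P : Phases) :
    ((qetu τ σ t P).map (Instr.gates κ)).sum = 1 + P.m * (2 * (⌈|t| / τ⌉₊ * κ) + 4) := by
  rw [qetu]
  generalize P.m = m
  induction m with
  | zero => simp [Instr.gates]
  | succ m ih =>
    rw [List.range_succ, List.flatMap_append, ← List.cons_append, List.map_append, List.sum_append,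
      ih]
    simp [gates_controlledEvolution, Instr.gates]
    ring

theorem gates_qetu_le {τ : ℝ} (hτ : 0 < τ) (σ : ℝ) {t : ℝ} (ht : 0 ≤ t) (κ : ℕ) (P : Phases) :
    (((qetu τ σ t P).map (Instr.gates κ)).sum : ℝ) ≤ (κ + 1) * (1 + P.m * (2 * (t / τ) + 6)) := by
  rw [gates_qetu, abs_of_nonneg ht]
  have h1 : (⌈t / τ⌉₊ : ℝ) ≤ t / τ + 1 := (Nat.ceil_lt_add_one (by positivity)).le
  have h2 : (⌈t / τ⌉₊ : ℝ) * κ ≤ (t / τ + 1) * κ := by gcongr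
  have h3 : 0 ≤ t / τ := by positivity
  have h4 : (0 : ℝ) ≤ κ := Nat.cast_nonneg κ
  have h5 : 2 * ((⌈t / τ⌉₊ : ℝ) * κ) + 4 ≤ (κ + 1) * (2 * (t / τ) + 6) := by nlinarith
  have h6 : (P.m : ℝ) * (2 * ((⌈t / τ⌉₊ : ℝ) * κ) + 4) ≤
      P.m * ((κ + 1) * (2 * (t / τ) + 6)) := by gcongr
  push_cast
  linarith

theorem gates_filters_le {A : MultiLevel} {Λ τ σ : ℝ} (hΛ : 0 < Λ) (hτ : 0 < τ)
    (ht : 0 ≤ A.cleanTime) (κ : ℕ) :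
    (((A.filters Λ τ σ).map (Instr.gates κ)).sum : ℝ) ≤
      (κ + 1) * (2 * A.levels + 2 + A.levelPhases.m *
        (2 * ((∑ l ∈ Finset.range A.levels, 2 ^ (l + 1) / Λ) / τ) + 6 * A.levels) +
        A.cleanPhases.m * (2 * (A.cleanTime / τ) + 6)) := by
  have h (L : ℕ) : ((((List.range L).flatMap fun l =>
      qetu τ σ (2 ^ (l + 1) / Λ) A.levelPhases ++ [.measure]).map (Instr.gates κ)).sum : ℝ) ≤
      (κ + 1) * (2 * L + A.levelPhases.m *
        (2 * ((∑ l ∈ Finset.range L, 2 ^ (l + 1) / Λ) / τ) + 6 * L)) := by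
    induction L with
    | zero => simp
    | succ L ih =>
      have h1 := gates_qetu_le hτ σ (t := 2 ^ (L + 1) / Λ) (by positivity) κ A.levelPhases
      rw [List.range_succ, List.flatMap_append, List.map_append, List.sum_append,
        List.flatMap_singleton, List.map_append, List.sum_append, Finset.sum_range_succ]
      simp only [List.map_cons, List.map_nil, List.sum_cons, List.sum_nil, Instr.gates, Nat.cast_add,
        Nat.cast_one, add_zero]
      have h2 : (0 : ℝ) ≤ κ := Nat.cast_nonneg κ
      have h3 : ((κ : ℝ) + 1) * (2 * (L + 1) + A.levelPhases.m *
          (2 * ((∑ l ∈ Finset.range L, 2 ^ (l + 1) / Λ + 2 ^ (L + 1) / Λ) / τ) + 6 * (L + 1))) =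
          (κ + 1) * (2 * L + A.levelPhases.m *
            (2 * ((∑ l ∈ Finset.range L, 2 ^ (l + 1) / Λ) / τ) + 6 * L)) +
          (κ + 1) * (1 + A.levelPhases.m * (2 * (2 ^ (L + 1) / Λ / τ) + 6)) + (κ + 1) := by
        ring
      rw [h3]
      linarith
  have h1 := h A.levels
  have h2 := gates_qetu_le hτ σ ht κ A.cleanPhases
  rw [MultiLevel.filters, List.map_append, List.sum_append, List.map_append, List.sum_append]
  simp only [List.map_cons, List.map_nil, List.sum_cons, List.sum_nil, Instr.gates, Nat.cast_add,
    Nat.cast_one, add_zero]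
  have h3 : (0 : ℝ) ≤ κ := Nat.cast_nonneg κ
  linarith

theorem initQueries_attempt {A : MultiLevel} {Λ τ σ : ℝ} (hτ : 0 < τ) :
    ((A.attempt Λ τ σ).map Instr.initQueries).sum = 1 := by
  rw [MultiLevel.attempt_eq, List.map_cons, List.sum_cons, List.sum_eq_zero]
  · rfl
  · intro x hx
    obtain ⟨g, hg, rfl⟩ := List.mem_map.1 hx
    have := (respectsCutoff_and_ne_initQuery_of_mem_filters hτ hg).2
    cases g <;> simp_all [Instr.initQueries]

/-! ### Choice of the parameters -/

/-- The number `L` of levels is the least one with `Λ t / 2 ≤ 2 ^ L`: the last level time `2 ^ L / Λ` is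
at least half the clean-up time `t`, and, if there are any levels, at most `t`. -/
theorem levels_bounds {Λ t : ℝ} (hΛ : Real.pi ≤ Λ) (ht0 : 0 < t) (ht1 : t ≤ 1) {L : ℕ}
    (hL : L = ⌈Real.logb 2 (Λ * t / 2)⌉₊) :
    t ≤ 2 * (2 ^ L / Λ) ∧ (2 : ℝ) ^ L ≤ Λ ∧
      ∑ l ∈ Finset.range L, (2 : ℝ) ^ (l + 1) / Λ ≤ 2 * t ∧ (L : ℝ) ≤ 2 * Real.log Λ := by
  have hΛ3 : 3 < Λ := Real.pi_gt_three.trans_le hΛ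
  have hΛ0 : 0 < Λ := by linarith
  have hx : 0 < Λ * t / 2 := by positivity
  have h1 : Λ * t / 2 ≤ 2 ^ L := by
    have := Nat.le_ceil (Real.logb 2 (Λ * t / 2))
    rwa [← hL, Real.logb_le_iff_le_rpow one_lt_two hx, Real.rpow_natCast] at this
  have hlog : 0 < Real.log Λ := Real.log_pos (by linarith)
  have h2 : t ≤ 2 * (2 ^ L / Λ) := by
    rw [mul_div_assoc', le_div_iff₀ hΛ0]
    linarith
  rcases le_or_gt (Real.logb 2 (Λ * t / 2)) 0 with h0 | h0
  · have hL0 : L = 0 := by rw [hL]; exact Nat.ceil_eq_zero.2 h0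
    refine ⟨h2, ?_, ?_, ?_⟩
    · rw [hL0]; linarith
    · rw [hL0]; simp [ht0.le]
    · rw [hL0]; simp [hlog.le]
  · have h3 : (L : ℝ) ≤ Real.logb 2 (Λ * t) := by
      have := (Nat.ceil_lt_add_one h0.le).le
      rw [← hL, Real.logb_div (by positivity) two_ne_zero, Real.logb_self_eq_one one_lt_two] at this
      linarith
    have h4 : (2 : ℝ) ^ L ≤ Λ * t := by
      rwa [Real.le_logb_iff_rpow_le one_lt_two (by positivity), Real.rpow_natCast] at h3
    have h5 : Λ * t ≤ Λ := mul_le_of_le_one_right hΛ0.le ht1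
    refine ⟨h2, h4.trans h5, ?_, ?_⟩
    · have h6 : ∑ l ∈ Finset.range L, (2 : ℝ) ^ (l + 1) / Λ = (2 * 2 ^ L - 2) / Λ := by
        generalize L = M
        induction M with
        | zero => simp
        | succ M ih => rw [Finset.sum_range_succ, ih]; ring
      rw [h6, div_le_iff₀ hΛ0]
      linarith
    · refine (h3.trans (Real.logb_le_logb_of_le one_lt_two (by positivity) h5)).trans ?_
      rw [Real.logb, div_le_iff₀ (Real.log_pos one_lt_two)]
      have := Real.log_two_gt_d9
      nlinarith

/-- The logarithmic overhead of the filters is polylogarithmic in the cost scale. -/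
theorem log_overhead_le {γ ε Y M : ℝ} (hγ : 0 < γ) (hγ1 : γ ≤ 1) (hε : 0 < ε) (hε1 : ε < 1)
    (hY : 1 ≤ Y) (hM0 : 0 < M) (hM : M ≤ 7680 * Y ^ 2 / (ε * γ)) :
    Real.log M ≤ 34 * Real.log (2 / ε) *
      Real.log (2 + γ⁻¹ ^ 2 * Y * Real.log (2 / ε)) := by
  set l := Real.log (2 / ε) with hl
  set X := γ⁻¹ ^ 2 * Y * l with hX
  have hlog2 := Real.log_two_gt_d9
  have hl2 : 1 / 2 ≤ l := by
    have : Real.log 2 ≤ l := Real.log_le_log two_pos (by rw [le_div_iff₀ hε]; linarith)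
    linarith
  have hX0 : 0 < X := by positivity
  set Lx := Real.log (2 + X) with hLx
  have hLx2 : Real.log 2 ≤ Lx := Real.log_le_log two_pos (by linarith)
  have hYX : γ⁻¹ ^ 2 * Y ≤ 2 * (2 + X) := by
    have : 0 ≤ γ⁻¹ ^ 2 * Y := by positivity
    nlinarith
  have h1 : M ≤ 2 ^ 14 * (2 + X) ^ 2 * (2 / ε) := by
    have h2 : (γ⁻¹ ^ 2 * Y) ^ 2 ≤ (2 * (2 + X)) ^ 2 := by gcongr
    have h3 : (1 : ℝ) ≤ γ⁻¹ := (one_le_inv₀ hγ).2 hγ1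
    have h4 : γ⁻¹ ≤ γ⁻¹ ^ 4 := le_self_pow₀ h3 (by norm_num)
    calc M ≤ 7680 * Y ^ 2 / (ε * γ) := hM
      _ = 3840 * (Y ^ 2 * γ⁻¹) * (2 / ε) := by field_simp; ring
      _ ≤ 3840 * (Y ^ 2 * γ⁻¹ ^ 4) * (2 / ε) := by gcongr
      _ = 3840 * (γ⁻¹ ^ 2 * Y) ^ 2 * (2 / ε) := by ring
      _ ≤ 3840 * (2 * (2 + X)) ^ 2 * (2 / ε) := by gcongr
      _ = 15360 * (2 + X) ^ 2 * (2 / ε) := by ring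
      _ ≤ _ := by gcongr; norm_num
  have h2 : Real.log M ≤ 14 * Real.log 2 + 2 * Lx + l := by
    refine (Real.log_le_log hM0 h1).trans (le_of_eq ?_)
    rw [Real.log_mul (by positivity) (by positivity), Real.log_mul (by positivity) (by positivity),
      Real.log_pow, Real.log_pow]
    push_cast
    ring
  have h3 : Lx ≤ 2 * (l * Lx) := by nlinarith
  have h4 : l ≤ 2 * (l * Lx) := by nlinarith
  nlinarith

/-- The cost of one attempt in terms of the parameters; `g = t Δ` is the spectral gap in
units of the clean-up time `t`, and `m`, `m'` are half the degrees of the two kinds of filters. -/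
theorem attempt_cost_le {Δ τ g t ℓ L m m' D s : ℝ} (hΔ : 0 < Δ) (hτ : 0 < τ)
    (ht : t = (max 1 Δ)⁻¹) (hg : g = t * Δ) (hℓ : 1 ≤ ℓ) (hL0 : 0 ≤ L) (hL : L ≤ 2 * ℓ)
    (hm : m ≤ 80 * D) (hm' : m' ≤ 80 / g * D) (hD : 1 ≤ D) (hs0 : 0 ≤ s) (hs : s ≤ 2 * t) :
    2 * L + 2 + m * (2 * (s / τ) + 6 * L) + m' * (2 * (t / τ) + 6) ≤
      1500 * (ℓ + (1 + τ⁻¹) * Δ⁻¹) * D := by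
  have hmax : 0 < max 1 Δ := by positivity
  have ht0 : 0 < t := by rw [ht]; positivity
  have htΔ : t ≤ Δ⁻¹ := by rw [ht]; exact inv_anti₀ hΔ (le_max_right _ _)
  have hg0 : 0 < g := by rw [hg]; positivity
  have hgi : g⁻¹ ≤ 1 + Δ⁻¹ := by
    have : g⁻¹ = max 1 Δ * Δ⁻¹ := by rw [hg, ht, mul_inv, inv_inv]
    rw [this]
    have h1 : max 1 Δ ≤ 1 + Δ := max_le (by linarith) (by linarith)
    calc max 1 Δ * Δ⁻¹ ≤ (1 + Δ) * Δ⁻¹ := by gcongr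
      _ = 1 + Δ⁻¹ := by field_simp; ring
  have htg : t * g⁻¹ = Δ⁻¹ := by rw [hg]; field_simp
  have hτ0 : 0 < τ⁻¹ := by positivity
  have hΔ0 : 0 < Δ⁻¹ := by positivity
  have h1 : m * (2 * (s / τ) + 6 * L) ≤ 80 * D * (4 * (Δ⁻¹ * τ⁻¹) + 12 * ℓ) := by
    have h2 : s / τ ≤ 2 * (Δ⁻¹ * τ⁻¹) := by
      rw [div_eq_mul_inv, ← mul_assoc]
      gcongr
      linarith
    have h3 : 0 ≤ s / τ := by positivity
    calc _ ≤ 80 * D * (2 * (s / τ) + 6 * L) := by gcongr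
      _ ≤ _ := mul_le_mul_of_nonneg_left (by linarith) (by positivity)
  have h2 : m' * (2 * (t / τ) + 6) ≤ 80 * D * (2 * (Δ⁻¹ * τ⁻¹) + 6 * (1 + Δ⁻¹)) := by
    have h3 : 0 ≤ t / τ := by positivity
    calc _ ≤ 80 / g * D * (2 * (t / τ) + 6) := by gcongr
      _ = 80 * D * (2 * ((t * g⁻¹) * τ⁻¹) + 6 * g⁻¹) := by field_simp
      _ ≤ _ := by rw [htg]; gcongr
  have h3 : 2 * L + 2 ≤ 6 * ℓ * D := by nlinarith
  have h4 : 0 < Δ⁻¹ * τ⁻¹ * D := by positivity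
  have h5 : 0 < Δ⁻¹ * D := by positivity
  have h6 : D ≤ ℓ * D := by nlinarith
  nlinarith

section Eigenvalues

variable {n : ℕ} {H : Sys n →L[ℂ] Sys n} {lam : Fin (2 ^ n) → ℝ}
  {psi : OrthonormalBasis (Fin (2 ^ n)) ℂ (Sys n)}

theorem IsEigensystem.le_norm (he : IsEigensystem H lam psi) (k : Fin (2 ^ n)) : lam k ≤ ‖H‖ := by
  have h := H.le_opNorm (psi k)
  rw [he.2 k, norm_smul, psi.norm_eq_one, mul_one, mul_one, Complex.norm_real] at h
  exact (le_abs_self _).trans h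

end Eigenvalues

end MultiLevelQETU

open MultiLevelQETU in
theorem mainTheorem3 :
    ∃ (C : ℝ) (k : ℕ),
      ∀ γ Λ Δ τ ε μ σ : ℝ,
        0 < γ → γ ≤ 1 → Real.pi ≤ Λ → 0 < Δ → 0 < τ → 0 < ε → ε < 1 → 0 ≤ σ →
        ε ≤ γ⁻¹ * (Real.logb 2 (Λ / 2))⁻¹ * Real.log (3 / 2) →
        ∃ (A : MultiLevel) (R : ℕ) (δ : ℝ),
          0 < δ ∧
          (Δ ≤ 1 → A.levels = ⌈Real.logb 2 (Λ / 2)⌉₊ ∧ A.cleanTime = 1) ∧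
          (A.totalInitQueries R Λ τ σ : ℝ) ≤ C * γ⁻¹ ^ 2 ∧
          (∀ κ : ℕ, (A.totalGates R κ Λ τ σ : ℝ) ≤
            C * (κ + 1) * costScale γ Λ Δ τ ε * Real.log (2 + costScale γ Λ Δ τ ε) ^ k) ∧
          ∀ (n : ℕ) (H : Sys n →L[ℂ] Sys n) (lam : Fin (2 ^ n) → ℝ)
            (psi : OrthonormalBasis (Fin (2 ^ n)) ℂ (Sys n))
            (OI : Sys n →L[ℂ] Sys n) (OH : ℝ → Sys n →L[ℂ] Sys n),
            H.IsPositive →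
            IsEigensystem H lam psi →
            ‖H‖ = Λ →
            lam 0 ≤ μ - Δ / 2 →
            (∀ j, j ≠ 0 → μ + Δ / 2 ≤ lam j) →
            σ ≤ lam 0 → lam 0 ≤ σ + Real.pi / 4 →
            OI ∈ unitary (Sys n →L[ℂ] Sys n) →
            ‖inner ℂ (OI (zeroSys n)) (psi 0)‖ = γ →
            IsCutoffEvolution τ δ H OH →
            2 / 3 ≤ A.successProb R Λ τ σ OI OH ∧
            1 - ε ≤ fidelity (psi 0) (A.output Λ τ σ OI OH) := by
  refine ⟨306000, 1, ?_⟩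
  intro γ Λ Δ τ ε μ σ hγ hγ1 hΛ hΔ hτ hε hε1 hσ0 _
  have hΛ0 : 0 < Λ := Real.pi_pos.trans_le hΛ
  have hπ3 := Real.pi_gt_d2
  -- The clean-up time is `1` for `Δ ≤ 1` and `1 / Δ` otherwise.
  obtain ⟨t, ht⟩ : ∃ t, t = (max 1 Δ)⁻¹ := ⟨_, rfl⟩
  have hmax : 1 ≤ max 1 Δ := le_max_left _ _
  have ht0 : 0 < t := by rw [ht]; positivity
  have ht1 : t ≤ 1 := by rw [ht]; exact inv_le_one_of_one_le₀ hmax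
  obtain ⟨g, hg⟩ : ∃ g, g = t * Δ := ⟨_, rfl⟩
  have hg0 : 0 < g := by rw [hg]; positivity
  have hg1 : g ≤ 1 := by
    rw [hg, ht, inv_mul_le_iff₀ (by positivity), mul_one]
    exact le_max_right _ _
  obtain ⟨L, hL⟩ : ∃ L, L = ⌈Real.logb 2 (Λ * t / 2)⌉₊ := ⟨_, rfl⟩
  obtain ⟨hL1, hL2, hL3, hL4⟩ := levels_bounds hΛ ht0 ht1 hL
  obtain ⟨η, hη⟩ : ∃ η, η = ε * γ / (16 * (L + 1)) := ⟨_, rfl⟩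
  have hη0 : 0 < η := by rw [hη]; positivity
  have hεγ : ε * γ ≤ 1 := mul_le_one₀ hε1.le hγ.le hγ1
  have hηL : η * (L + 1) = ε * γ / 16 := by rw [hη]; field_simp
  have hηε : η ≤ ε * γ / 16 := by
    rw [← hηL]
    exact le_mul_of_one_le_right hη0.le (by linarith [L.cast_nonneg (α := ℝ)])
  have hη1 : η < 1 := by linarith
  -- The clean-up filter has its transition region between the largest possible angle of the ground
  -- state and the smallest possible angle of an excited state.
  obtain ⟨θa, hθa⟩ : ∃ θa, θa = max 0 (min (Real.pi / 4) (t * (μ - σ) - g / 2)) := ⟨_, rfl⟩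
  have hθa0 : 0 ≤ θa := by rw [hθa]; exact le_max_left _ _
  have hθa1 : θa ≤ Real.pi / 4 := by
    rw [hθa]; exact max_le (by positivity) (min_le_left _ _)
  obtain ⟨P, hPm, hP⟩ := exists_phases_filter (θa := Real.pi / 4) (θb := Real.pi / 2)
    (by positivity) (by linarith) (by linarith) hη0 hη1
  obtain ⟨Q, hQm, hQ⟩ := exists_phases_filter (θa := θa) (θb := θa + g) hθa0 (by linarith)
    (by linarith) hη0 hη1
  obtain ⟨A, hA⟩ : ∃ A : MultiLevel, A = ⟨L, P, Q, t⟩ := ⟨_, rfl⟩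
  have hAL : A.levels = L := by rw [hA]
  have hAP : A.levelPhases = P := by rw [hA]
  have hAQ : A.cleanPhases = Q := by rw [hA]
  have hAt : A.cleanTime = t := by rw [hA]
  obtain ⟨N, hN⟩ : ∃ N, N = (A.attempt Λ τ σ).length := ⟨_, rfl⟩
  have hγ2 : (1 : ℝ) ≤ γ⁻¹ ^ 2 := one_le_pow₀ ((one_le_inv₀ hγ).2 hγ1)
  have hR : (⌈5 / γ ^ 2⌉₊ : ℝ) ≤ 6 * γ⁻¹ ^ 2 := by
    have h1 := (Nat.ceil_lt_add_one (a := 5 / γ ^ 2) (by positivity)).le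
    have h2 : 5 / γ ^ 2 = 5 * γ⁻¹ ^ 2 := by rw [inv_pow, div_eq_mul_inv]
    linarith
  refine ⟨A, ⌈5 / γ ^ 2⌉₊, ε * γ / 16 / (N + 1), by positivity, ?_, ?_, ?_, ?_⟩
  · intro hΔ1
    have ht' : t = 1 := by rw [ht, max_eq_left hΔ1, inv_one]
    rw [hAL, hAt, hL, ht', mul_one]
    exact ⟨rfl, rfl⟩
  · rw [MultiLevel.totalInitQueries, initQueries_attempt hτ, mul_one]
    linarith
  · intro κ
    have hκ : (0 : ℝ) ≤ κ := Nat.cast_nonneg κ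
    have hℓ : 1 ≤ Real.log Λ := by
      rw [Real.le_log_iff_exp_le hΛ0]
      linarith [Real.exp_one_lt_d9]
    obtain ⟨Y, hY⟩ : ∃ Y, Y = Real.log Λ + (1 + τ⁻¹) * Δ⁻¹ := ⟨_, rfl⟩
    have hΔi : 0 < Δ⁻¹ := by positivity
    have hτi : 0 < τ⁻¹ * Δ⁻¹ := by positivity
    have hY1 : Real.log Λ + Δ⁻¹ ≤ Y := by rw [hY]; linarith
    obtain ⟨M, hM⟩ : ∃ M, M = 160 / (g * η) := ⟨_, rfl⟩
    have hM0 : 0 < M := by rw [hM]; positivity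
    have hMη : 160 / η ≤ M := by
      rw [hM]
      exact div_le_div_of_nonneg_left (by norm_num) (by positivity)
        (mul_le_of_le_one_left hη0.le hg1)
    have hM160 : 160 ≤ M := le_trans (by rw [le_div_iff₀ hη0]; linarith) hMη
    have hD : 1 ≤ Real.log M := by
      rw [Real.le_log_iff_exp_le hM0]
      linarith [Real.exp_one_lt_d9]
    have hm : (A.levelPhases.m : ℝ) ≤ 80 * Real.log M := by
      rw [hAP]
      rw [show Real.pi / 2 - Real.pi / 4 = Real.pi / 4 by ring] at hPm
      refine hPm.trans ?_
      have h1 : 62 / (Real.pi / 4) ≤ 80 := by rw [div_le_iff₀ (by positivity)]; linarith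
      have h2 : Real.log (124 / (Real.pi / 4 * η)) ≤ Real.log M := by
        refine Real.log_le_log (by positivity) (le_trans ?_ hMη)
        rw [← div_div]
        gcongr
        rw [div_le_iff₀ (by positivity)]
        linarith
      calc _ ≤ 62 / (Real.pi / 4) * Real.log M := by gcongr
        _ ≤ _ := by gcongr
    have hm' : (A.cleanPhases.m : ℝ) ≤ 80 / g * Real.log M := by
      rw [hAQ]
      rw [show θa + g - θa = g by ring] at hQm
      refine hQm.trans ?_
      have h2 : Real.log (124 / (g * η)) ≤ Real.log M := by
        refine Real.log_le_log (by positivity) ?_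
        rw [hM]
        gcongr
        norm_num
      calc _ ≤ 62 / g * Real.log M := by gcongr
        _ ≤ _ := by gcongr; norm_num
    have hcost := attempt_cost_le hΔ hτ ht hg hℓ L.cast_nonneg hL4 hm hm' hD
      (Finset.sum_nonneg fun _ _ => by positivity) hL3
    have hgates := gates_filters_le (A := A) (σ := σ) hΛ0 hτ (by rw [hAt]; exact ht0.le) κ
    rw [hAL, hAt] at hgates
    have hlog : Real.log M ≤ 34 * Real.log (2 / ε) *
        Real.log (2 + γ⁻¹ ^ 2 * Y * Real.log (2 / ε)) := by
      refine log_overhead_le hγ hγ1 hε hε1 (by linarith) hM0 ?_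
      have h1 : (L : ℝ) + 1 ≤ 3 * Y := by linarith
      have h2 : g⁻¹ ≤ Y := by
        have : g⁻¹ = max 1 Δ * Δ⁻¹ := by rw [hg, ht, mul_inv, inv_inv]
        rw [this, max_mul_of_nonneg _ _ hΔi.le, mul_inv_cancel₀ hΔ.ne', one_mul]
        exact max_le (by linarith) (by linarith)
      calc M = 2560 * ((L + 1) * g⁻¹) / (ε * γ) := by
            rw [hM, hη]; field_simp; ring
        _ ≤ 2560 * (3 * Y * Y) / (ε * γ) := by gcongr; linarith
        _ = _ := by ring
    rw [MultiLevel.totalGates, MultiLevel.attempt_eq, List.map_cons, List.sum_cons, Instr.gates,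
      zero_add, costScale, ← hY, pow_one]
    rw [← hY] at hcost
    push_cast [-Nat.cast_list_sum]
    have hY0 : 0 ≤ Y := by linarith
    obtain ⟨l, hl⟩ : ∃ l, l = Real.log (2 / ε) := ⟨_, rfl⟩
    obtain ⟨W, hW⟩ : ∃ W, W = Real.log (2 + γ⁻¹ ^ 2 * Y * l) := ⟨_, rfl⟩
    rw [← hl, ← hW] at hlog ⊢
    calc _ ≤ 6 * γ⁻¹ ^ 2 * ((κ + 1) * (1500 * Y * Real.log M)) := by
          refine mul_le_mul hR (hgates.trans ?_) (Nat.cast_nonneg _) (by positivity)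
          gcongr
      _ ≤ 6 * γ⁻¹ ^ 2 * ((κ + 1) * (1500 * Y * (34 * l * W))) := by gcongr
      _ = _ := by ring
  · intro n H lam psi OI OH _ he hH hlam0 hlam hσ hσπ hOI hinit hOH
    have hu0 : t * (lam 0 - σ) ≤ t * (μ - σ) - g / 2 := by
      have : t * (lam 0 - σ) ≤ t * (μ - Δ / 2 - σ) := by gcongr
      rw [hg]
      linarith
    have hu0' : 0 ≤ t * (lam 0 - σ) := mul_nonneg ht0.le (by linarith)
    have hθa2 : θa ≤ t * (μ - σ) - g / 2 := by
      rw [hθa]; exact max_le (hu0'.trans hu0) (min_le_right _ _)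
    have hθa3 : t * (lam 0 - σ) ≤ θa := by
      rw [hθa]
      refine le_max_of_le_right (le_min ?_ hu0)
      exact (mul_le_of_le_one_left (by linarith) ht1).trans (by linarith)
    rw [← hAP] at hP
    rw [← hAQ] at hQ
    have hground : 7 / 8 ≤ ‖A.amplitude Λ τ σ (lam 0)‖ :=
      MultiLevel.le_norm_amplitude hτ hP hQ hΛ0 (by rwa [hAL]) (by rw [hAt]; exact ht0.le) hσ hσπ
        (by rwa [hAt]) hη0.le (by rw [hAL]; linarith)
    have hexc : ∀ k, k ≠ 0 → ‖A.amplitude Λ τ σ (lam k)‖ ≤ ε * γ / 16 := by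
      intro k hk
      have h1 : lam 0 ≤ lam k := he.1 (Fin.le_def.2 (Nat.zero_le _))
      have h2 := he.le_norm k
      have h3 : t * (μ + Δ / 2 - σ) ≤ t * (lam k - σ) := by gcongr; exact hlam k hk
      refine (MultiLevel.norm_amplitude_le hτ hP hQ hΛ0 (by rwa [hAL, hAt]) (hσ.trans h1)
        (by linarith) ?_).trans hηε
      rw [hAt]
      rw [hg] at *
      linarith
    have hlen : (A.attempt Λ τ σ).length * (ε * γ / 16 / (N + 1)) ≤ ε * γ / 16 := by
      rw [← hN, mul_div_assoc', div_le_iff₀ (by positivity)]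
      have : 0 < ε * γ / 16 := by positivity
      linarith
    obtain ⟨h1, h2⟩ := output_bounds he hτ (by positivity) hγ hε hε1 hOI hOH hinit hground hexc hlen
    refine ⟨two_thirds_le_retryProb hγ h1 ?_, h2⟩
    exact pow_le_one₀ (norm_nonneg _) (norm_output_le_one hτ hOI hOH)
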